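/- All Hilbert spaces are finite-dimensional, and logarithms are to base $2$. A *source* on $\mathcal H$ is a sequence of bipartite pure states $\Psi^{(n)}$ on $\mathcal R^{(n)}\otimes\mathcal H^{\otimes n}$, where the reference system $\mathcal R^{(n)}$ is arbitrary and is not transmitted. Let $\varrho^{(n)}$ be the reduced state of $\Psi^{(n)}$ on $\mathcal H^{\otimes n}$. The source has rate $R$ if $\lim_{n\to\infty} S(\varrho^{(n)})/n$ exists and equals $R$, with $S$ the von Neumann entropy. No further property, in particular no quantum asymptotic equipartition property (QAEP), is assumed. Let $k$ senders have channel input spaces $\mathcal H_{1},\dots,\mathcal H_{k}$, and let $\Lambda$ be a completely positive trace-preserving map of one of the following two kinds. - Multiple access channel (MAC): $\Lambda$ maps $\mathcal B(\bigotimes_i\mathcal H_i)$ to $\mathcal B(\mathcal K)$, where $\mathcal K$ belongs to a single receiver. - $k$-user channel ($k$-UC): $\Lambda$ maps $\mathcal B(\bigotimes_i\mathcal H_i)$ to $\mathcal B(\bigotimes_{i}\mathcal K_i)$, where $\mathcal K_i$ belongs to receiver $i$, and sender $i$ transmits to receiver $i$. Let $\mathcal A_i$ be the source space of sender $i$. A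 protocol $P=\{\mathcal D^{(n)},\bigotimes_i\varepsilon_i^{(n)}\}$ without classical communication consists, for each $n$, of completely positive trace-nonincreasing encodings $\varepsilon_i^{(n)}:\mathcal B(\mathcal A_i^{\otimes n})\to\mathcal B(\mathcal H_i^{\otimes n})$ and a completely positive trace-nonincreasing decoding $\mathcal D^{(n)}$ from the output of $\Lambda^{\otimes n}$ to $\mathcal B(\bigotimes_i\mathcal A_i^{\otimes n})$. For a MAC, $\mathcal D^{(n)}$ is an arbitrary joint map; for a $k$-UC, $\mathcal D^{(n)}=\bigotimes_i\mathcal D_i^{(n)}$ with $\mathcal D_i^{(n)}:\mathcal B(\mathcal K_i^{\otimes n})\to\mathcal B(\mathcal A_i^{\otimes n})$ again completely positive and trace-nonincreasing. The protocol is reliable for sources $\Psi_i^{(n)}$ on $\mathcal A_i$ if, with $\Psi^{(n)}=\bigotimes_i\Psi_i^{(n)}$, the entanglement fidelity $$\langle\Psi^{(n)}|\,\bigl(\mathrm{id}\otimes \mathcal D^{(n)}\Lambda^{\otimes n}\textstyle\bigotimes_i\varepsilon_i^{(n)}\bigr)\bigl(|\Psi^{(n)}\rangle\langle\Psi^{(n)}|\bigr)\,|\Psi^{(n)}\rangle$$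 tends to $1$ as $n\to\infty$. **Theorem 3** (entanglement capacities without encodings: MAC and $k$-UC). Let $\Lambda$ be a MAC or a $k$-UC, and let $P=\{\mathcal D^{(n)},\bigotimes_i\varepsilon_i^{(n)}\}$ be a protocol that is reliable for sources on $\mathcal A_1,\dots,\mathcal A_k$ with rates $R_1,\dots,R_k$. Then there exist completely positive trace-preserving maps $\tilde{\mathcal D}_i^{(n)}:\mathcal B(\mathcal A_i^{\otimes n})\to\mathcal B(\mathcal H_i^{\otimes n})$ and sources on the channel input spaces $\mathcal H_1,\dots,\mathcal H_k$ with the same rates $R_1,\dots,R_k$, such that $\tilde P=\{(\bigotimes_i\tilde{\mathcal D}_i^{(n)})\,\mathcal D^{(n)},\ \mathbb I\}$, whose encodings are the identity, is a protocol of the same kind (MAC or $k$-UC) for the source spaces $\mathcal H_i$ and is reliable for these new sources. -/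

import Mathlib

open Filter Topology
open scoped ComplexOrder Matrix

namespace MultiuserQuantum

universe u v w

noncomputable section

/-- Linear maps `B(ℂ^a) → B(ℂ^b)`.  A finite-dimensional Hilbert space is `ℂ^a` for a finite index
type `a`; a tensor product of such spaces is indexed by the product of the index types. -/
abbrev SuperOp (a : Type u) (b : Type v) : Type (max u v) :=
  Matrix a a ℂ →ₗ[ℂ] Matrix b b ℂ

/-- The map `id_r ⊗ Φ`, applied to an operator `X` on `ℂ^r ⊗ ℂ^a`. -/
def ampliate {r : Type w} {a : Type u} {b : Type v} (Φ : SuperOp a b)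
    (X : Matrix (r × a) (r × a) ℂ) : Matrix (r × b) (r × b) ℂ :=
  Matrix.of fun p q => Φ (Matrix.of fun x y => X (p.1, x) (q.1, y)) p.2 q.2

/-- Complete positivity: every `id_{ℂ^m} ⊗ Φ` maps positive operators to positive operators. -/
def IsCompletelyPositive {a : Type u} {b : Type v} (Φ : SuperOp a b) : Prop :=
  ∀ (m : ℕ) (X : Matrix (Fin m × a) (Fin m × a) ℂ), X.PosSemidef → (ampliate Φ X).PosSemidef

/-- Completely positive trace-nonincreasing maps. -/
structure IsOperation {a : Type u} {b : Type v} [Fintype a] [Fintype b]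
    (Φ : SuperOp a b) : Prop where
  completelyPositive : IsCompletelyPositive Φ
  trace_le : ∀ X : Matrix a a ℂ, X.PosSemidef → (Φ X).trace.re ≤ X.trace.re

/-- Quantum channels: completely positive trace-preserving maps. -/
structure IsChannel {a : Type u} {b : Type v} [Fintype a] [Fintype b]
    (Φ : SuperOp a b) : Prop where
  completelyPositive : IsCompletelyPositive Φ
  trace_eq : ∀ X : Matrix a a ℂ, (Φ X).trace = X.trace

/-- The tensor product `⨂ i, Φ i`, the linear map that sends the matrix unit
`⨂ i, |x i⟩⟨x' i|` to `⨂ i, Φ i (|x i⟩⟨x' i|)`. -/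
def tensorMap {ι : Type w} [Fintype ι] [DecidableEq ι] {a : ι → Type u} {b : ι → Type v}
    [∀ i, Fintype (a i)] [∀ i, DecidableEq (a i)]
    (Φ : ∀ i, SuperOp (a i) (b i)) : SuperOp (∀ i, a i) (∀ i, b i) where
  toFun X := Matrix.of fun y y' =>
    ∑ x, ∑ x', X x x' * ∏ i, Φ i (Matrix.single (x i) (x' i) 1) (y i) (y' i)
  map_add' X Y := by
    ext y y'
    simp [add_mul, Finset.sum_add_distrib]
  map_smul' c X := by
    ext y y'
    simp [Finset.mul_sum, mul_assoc]

/-- Relabelling of the basis of a Hilbert space, as a map on operators. -/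
def relabel {a : Type u} {b : Type v} (e : a ≃ b) : SuperOp a b :=
  (Matrix.reindexLinearEquiv ℂ ℂ e e).toLinearMap

/-- `Λ^{⊗n}` for a channel with `k` senders and one receiver; the `n` input systems of each sender
are grouped together. -/
def macUses {k : ℕ} {a : Fin k → Type u} {o : Type v}
    [∀ i, Fintype (a i)] [∀ i, DecidableEq (a i)]
    (Λ : SuperOp (∀ i, a i) o) (n : ℕ) : SuperOp (∀ i, Fin n → a i) (Fin n → o) :=
  (tensorMap fun _ : Fin n => Λ) ∘ₗ
    relabel (Equiv.piComm fun (i : Fin k) (_ : Fin n) => a i)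

/-- `Λ^{⊗n}` for a channel with `k` senders and `k` receivers; the `n` input systems of each sender
and the `n` output systems of each receiver are grouped together. -/
def kucUses {k : ℕ} {a : Fin k → Type u} {o : Fin k → Type v}
    [∀ i, Fintype (a i)] [∀ i, DecidableEq (a i)]
    (Λ : SuperOp (∀ i, a i) (∀ i, o i)) (n : ℕ) :
    SuperOp (∀ i, Fin n → a i) (∀ i, Fin n → o i) :=
  relabel (Equiv.piComm fun (_ : Fin n) (i : Fin k) => o i) ∘ₗ
    (tensorMap fun _ : Fin n => Λ) ∘ₗ
    relabel (Equiv.piComm fun (i : Fin k) (_ : Fin n) => a i)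

/-- A bipartite unit vector in `ℂ^r ⊗ ℂ^a`: `r` is the reference kept by the sender, `a` is the
system that is sent. -/
structure PureState (r : Type u) (a : Type v) [Fintype r] [Fintype a] where
  amp : r × a → ℂ
  norm_one : ∑ p, ‖amp p‖ ^ 2 = 1

/-- The reduced density matrix `ϱ = tr_r |Ψ⟩⟨Ψ|` of the system that is sent. -/
def PureState.reduced {r : Type u} {a : Type v} [Fintype r] [Fintype a]
    (Ψ : PureState r a) : Matrix a a ℂ :=
  Matrix.of fun x y => ∑ j, Ψ.amp (j, x) * star (Ψ.amp (j, y))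

theorem PureState.reduced_posSemidef {r : Type u} {a : Type v} [Fintype r] [Fintype a]
    (Ψ : PureState r a) : Ψ.reduced.PosSemidef := by
  have h : Ψ.reduced = (Matrix.of fun (x : a) (j : r) => Ψ.amp (j, x)) *
      (Matrix.of fun (x : a) (j : r) => Ψ.amp (j, x))ᴴ := by
    ext x y
    simp [PureState.reduced, Matrix.mul_apply]
  rw [h]
  exact Matrix.posSemidef_self_mul_conjTranspose _

/-- The von Neumann entropy `S(ϱ) = -tr ϱ log₂ ϱ` of the reduced density matrix. -/
def PureState.entropy {r : Type u} {a : Type v} [Fintype r] [Fintype a] [DecidableEq a]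
    (Ψ : PureState r a) : ℝ :=
  -∑ x, Ψ.reduced_posSemidef.1.eigenvalues x *
    Real.logb 2 (Ψ.reduced_posSemidef.1.eigenvalues x)

/-- The global entanglement fidelity `F_e(⨂ᵢ Ψᵢ, Φ) = ⟨Ψ| (id ⊗ Φ)(|Ψ⟩⟨Ψ|) |Ψ⟩` with
`Ψ = ⨂ᵢ Ψᵢ`, where `Φ` acts jointly on all the systems that are sent. -/
def entanglementFidelity {k : ℕ} {r : Fin k → Type u} {a : Fin k → Type v}
    [∀ i, Fintype (r i)] [∀ i, Fintype (a i)]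
    (Ψ : ∀ i, PureState (r i) (a i)) (Φ : SuperOp (∀ i, a i) (∀ i, a i)) : ℝ :=
  let v : (∀ i, r i) × (∀ i, a i) → ℂ := fun p => ∏ i, (Ψ i).amp (p.1 i, p.2 i)
  (star v ⬝ᵥ (ampliate Φ (Matrix.vecMulVec v (star v)) *ᵥ v)).re

/-- A source with one-letter space `ℂ^s`: for each block length `n` a bipartite pure state
`Ψ^{(n)}` whose sent system is `(ℂ^s)^{⊗n}`, with a reference of arbitrary finite dimension. -/
structure Source (s : Type u) [Fintype s] where
  refDim : ℕ → ℕ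
  state : ∀ n : ℕ, PureState (Fin (refDim n)) (Fin n → s)

/-- The source has entropy rate `R = lim S(ϱ^{(n)}) / n` (the limit exists). -/
def Source.HasRate {s : Type u} [Fintype s] [DecidableEq s] (S : Source s) (R : ℝ) : Prop :=
  Tendsto (fun n : ℕ => (S.state n).entropy / n) atTop (𝓝 R)

/-- A protocol without classical communication for a multiple access channel: product encodings,
one for each of the `k` senders, and a joint decoding by the receiver.  Sender `i` holds
`(ℂ^(s i))^{⊗n}` and encodes it into her `n` channel inputs `(ℂ^(a i))^{⊗n}`. -/
structure MACProtocol {k : ℕ} (s : Fin k → Type u) (a : Fin k → Type v) (o : Type w)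
    [∀ i, Fintype (s i)] [∀ i, Fintype (a i)] [Fintype o] where
  enc : ∀ (n : ℕ) (i : Fin k), SuperOp (Fin n → s i) (Fin n → a i)
  dec : ∀ n : ℕ, SuperOp (Fin n → o) (∀ i, Fin n → s i)
  enc_isOperation : ∀ n i, IsOperation (enc n i)
  dec_isOperation : ∀ n, IsOperation (dec n)

/-- The effective map `𝒟^{(n)} Λ^{⊗n} (⨂ᵢ ε_i^{(n)})`. -/
def MACProtocol.effective {k : ℕ} {s : Fin k → Type u} {a : Fin k → Type v} {o : Type w}
    [∀ i, Fintype (s i)] [∀ i, DecidableEq (s i)] [∀ i, Fintype (a i)] [∀ i, DecidableEq (a i)]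
    [Fintype o] (P : MACProtocol s a o) (Λ : SuperOp (∀ i, a i) o) (n : ℕ) :
    SuperOp (∀ i, Fin n → s i) (∀ i, Fin n → s i) :=
  P.dec n ∘ₗ macUses Λ n ∘ₗ tensorMap (P.enc n)

/-- The protocol transmits the sources `S i` reliably through `Λ`. -/
def MACProtocol.IsReliable {k : ℕ} {s : Fin k → Type u} {a : Fin k → Type v} {o : Type w}
    [∀ i, Fintype (s i)] [∀ i, DecidableEq (s i)] [∀ i, Fintype (a i)] [∀ i, DecidableEq (a i)]
    [Fintype o] (P : MACProtocol s a o) (Λ : SuperOp (∀ i, a i) o)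
    (S : ∀ i, Source (s i)) : Prop :=
  Tendsto (fun n : ℕ => entanglementFidelity (fun i => (S i).state n) (P.effective Λ n))
    atTop (𝓝 1)

/-- A protocol without classical communication for a `k`-user channel: sender `i` transmits to
receiver `i`, encodings and decodings are local. -/
structure KUCProtocol {k : ℕ} (s : Fin k → Type u) (a : Fin k → Type v) (o : Fin k → Type w)
    [∀ i, Fintype (s i)] [∀ i, Fintype (a i)] [∀ i, Fintype (o i)] where
  enc : ∀ (n : ℕ) (i : Fin k), SuperOp (Fin n → s i) (Fin n → a i)
  dec : ∀ (n : ℕ) (i : Fin k), SuperOp (Fin n → o i) (Fin n → s i)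
  enc_isOperation : ∀ n i, IsOperation (enc n i)
  dec_isOperation : ∀ n i, IsOperation (dec n i)

/-- The effective map `(⨂ᵢ 𝒟_i^{(n)}) Λ^{⊗n} (⨂ᵢ ε_i^{(n)})`. -/
def KUCProtocol.effective {k : ℕ} {s : Fin k → Type u} {a : Fin k → Type v} {o : Fin k → Type w}
    [∀ i, Fintype (s i)] [∀ i, DecidableEq (s i)] [∀ i, Fintype (a i)] [∀ i, DecidableEq (a i)]
    [∀ i, Fintype (o i)] [∀ i, DecidableEq (o i)]
    (P : KUCProtocol s a o) (Λ : SuperOp (∀ i, a i) (∀ i, o i)) (n : ℕ) :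
    SuperOp (∀ i, Fin n → s i) (∀ i, Fin n → s i) :=
  tensorMap (P.dec n) ∘ₗ kucUses Λ n ∘ₗ tensorMap (P.enc n)

/-- The protocol transmits the sources `S i` reliably through `Λ`. -/
def KUCProtocol.IsReliable {k : ℕ} {s : Fin k → Type u} {a : Fin k → Type v}
    {o : Fin k → Type w}
    [∀ i, Fintype (s i)] [∀ i, DecidableEq (s i)] [∀ i, Fintype (a i)] [∀ i, DecidableEq (a i)]
    [∀ i, Fintype (o i)] [∀ i, DecidableEq (o i)]
    (P : KUCProtocol s a o) (Λ : SuperOp (∀ i, a i) (∀ i, o i))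
    (S : ∀ i, Source (s i)) : Prop :=
  Tendsto (fun n : ℕ => entanglementFidelity (fun i => (S i).state n) (P.effective Λ n))
    atTop (𝓝 1)

end

end MultiuserQuantum

/-! The channel uses and the decoding are merged into one operation `G`, so the two kinds of channel
differ only in how the final decoding is assembled. It then suffices to work with amplitudes of
vectors.

Let `Ψ = ⨂ Ψᵢ` be transmitted with fidelity `F`, and let `f` with `√F ≤ f` be the amplitude reached
below. Averaging over the Kraus operators of the encodings gives a product unit vector `N = ⨂ Nᵢ`
that `G` takes to `Ψ` with fidelity at least `F` (`exists_pure_inputs`). A normalized combination of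
the Kraus operators of `G` is a contraction `K` with `⟨Ψ, K N⟩ = f` (`exists_contraction`). Fixing
the vectors `Ψⱼ`, `Nⱼ` of all other senders turns `K` into local contractions `κᵢ` with `⟨Ψᵢ, κᵢ Nᵢ⟩
= f` (`localOp`).

The new state `Φᵢ` is the normalization of `κᵢᴴ Ψᵢ`, and `κᵢᴴ` is also taken as a Kraus operator of
the local channel `Dᵢ`. When `F` is near one, `Φ` is close to `N`, and both `K Φ` and `(⨂ κᵢ) Φ` are
close to `Ψ`. Hence `⟨Φ, (⨂ κᵢᴴ) K Φ⟩` is near one, and it bounds the square root of the new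
fidelity from below (`exists_recovery`).

This choice of `Φᵢ` also controls the entropy: `qᵢ²` times its reduced state is `κᵢᴴ ρᵢ κᵢ`, with
`qᵢ = ‖κᵢᴴ Ψᵢ‖` near one. A contraction cannot increase the number of eigenvalues above a positive
threshold (`card_eigenvalues_ge_le`), and such a domination of spectra bounds the difference of
entropies (`abs_sum_negMulLog_sub_le`). Only the logarithms of the source and input dimensions
enter, which are linear in `n`, so the rates agree without any regularity of the sources. -/

namespace MultiuserQuantum

noncomputable section

open scoped MatrixOrder Matrix.Norms.L2Operator in
theorem exists_eq_conjTranspose_mul_self {a : Type*} [Fintype a] {M : Matrix a a ℂ}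
    (h : M.PosSemidef) : ∃ B : Matrix a a ℂ, M = Bᴴ * B := by
  classical
  exact CStarAlgebra.nonneg_iff_eq_star_mul_self.1 h.nonneg

/-! ### Tensor products of matrices and of maps -/

section Tensor

variable {ι : Type*} [Fintype ι] {a b c : ι → Type*}

/-- The tensor product `⨂ i, M i` of a family of matrices. -/
def tens (M : ∀ i, Matrix (a i) (b i) ℂ) : Matrix (∀ i, a i) (∀ i, b i) ℂ :=
  Matrix.of fun x y => ∏ i, M i (x i) (y i)

theorem tens_apply (M : ∀ i, Matrix (a i) (b i) ℂ) (x : ∀ i, a i) (y : ∀ i, b i) :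
    tens M x y = ∏ i, M i (x i) (y i) := rfl

theorem tens_mul [DecidableEq ι] [∀ i, Fintype (b i)] (M : ∀ i, Matrix (a i) (b i) ℂ)
    (N : ∀ i, Matrix (b i) (c i) ℂ) : tens (fun i => M i * N i) = tens M * tens N := by
  ext x y
  simp only [tens_apply, Matrix.mul_apply, Fintype.prod_sum, Finset.prod_mul_distrib]

theorem tens_sum [DecidableEq ι] {L : ι → Type*} [∀ i, Fintype (L i)]
    (M : ∀ i, L i → Matrix (a i) (b i) ℂ) :
    tens (fun i => ∑ l, M i l) = ∑ l : ∀ i, L i, tens fun i => M i (l i) := by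
  ext x y
  simp only [tens_apply, Matrix.sum_apply, Fintype.prod_sum]

theorem tens_conjTranspose (M : ∀ i, Matrix (a i) (b i) ℂ) :
    (tens M)ᴴ = tens fun i => (M i)ᴴ := by
  ext x y
  simp [tens_apply]

theorem tens_transpose (M : ∀ i, Matrix (a i) (b i) ℂ) :
    (tens M)ᵀ = tens fun i => (M i)ᵀ := rfl

theorem tens_single [∀ i, DecidableEq (a i)] [∀ i, DecidableEq (b i)]
    (x : ∀ i, a i) (y : ∀ i, b i) :
    tens (fun i => Matrix.single (x i) (y i) (1 : ℂ)) = Matrix.single x y 1 := by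
  classical
  ext x' y'
  by_cases h : x = x' ∧ y = y'
  · obtain ⟨rfl, rfl⟩ := h
    simp [tens_apply]
  · rw [Matrix.single_apply_of_ne _ _ _ _ _ h, tens_apply]
    have : ∃ i, ¬(x i = x' i ∧ y i = y' i) := by
      by_contra! h'
      exact h ⟨funext fun i => (h' i).1, funext fun i => (h' i).2⟩
    obtain ⟨i, hi⟩ := this
    exact Finset.prod_eq_zero (Finset.mem_univ i) (Matrix.single_apply_of_ne _ _ _ _ _ hi)

theorem tens_one [∀ i, DecidableEq (a i)] :
    tens (fun i => (1 : Matrix (a i) (a i) ℂ)) = 1 := by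
  classical
  ext x y
  by_cases h : x = y
  · subst h
    simp [tens_apply]
  · rw [Matrix.one_apply_ne h, tens_apply]
    obtain ⟨i, hi⟩ := Function.ne_iff.1 h
    exact Finset.prod_eq_zero (Finset.mem_univ i) (Matrix.one_apply_ne hi)

theorem tensorMap_tens [DecidableEq ι] [∀ i, Fintype (a i)] [∀ i, DecidableEq (a i)]
    (Φ : ∀ i, SuperOp (a i) (b i)) (X : ∀ i, Matrix (a i) (a i) ℂ) :
    tensorMap Φ (tens X) = tens fun i => Φ i (X i) := by
  have key : ∀ i (y y' : b i), Φ i (X i) y y' =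
      ∑ x, ∑ x', X i x x' * Φ i (Matrix.single x x' 1) y y' := by
    intro i y y'
    conv_lhs => rw [Matrix.matrix_eq_sum_single (X i)]
    simp only [map_sum, Matrix.sum_apply]
    refine Finset.sum_congr rfl fun x _ => Finset.sum_congr rfl fun x' _ => ?_
    have : Matrix.single x x' (X i x x') = X i x x' • Matrix.single x x' (1 : ℂ) := by simp
    rw [this, map_smul, Matrix.smul_apply, smul_eq_mul]
  ext y y'
  simp only [tens_apply, key, Fintype.prod_sum, tensorMap, LinearMap.coe_mk, AddHom.coe_mk,
    Matrix.of_apply, Finset.prod_mul_distrib]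

/-- Matrix units are product operators, so product operators span. Identities about `tensorMap` are
thereby checked on products only. -/
theorem superOp_ext_tens {d : Type*} [∀ i, Fintype (a i)]
    {Φ Ψ : SuperOp (∀ i, a i) d} (h : ∀ X : ∀ i, Matrix (a i) (a i) ℂ, Φ (tens X) = Ψ (tens X)) :
    Φ = Ψ := by
  classical
  refine Matrix.ext_linearMap ℂ fun x y => LinearMap.ext_ring ?_
  simpa [tens_single] using h fun i => Matrix.single (x i) (y i) 1

theorem tensorMap_comp [DecidableEq ι] [∀ i, Fintype (a i)] [∀ i, DecidableEq (a i)]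
    [∀ i, Fintype (b i)] [∀ i, DecidableEq (b i)]
    (Φ : ∀ i, SuperOp (b i) (c i)) (Ψ : ∀ i, SuperOp (a i) (b i)) :
    tensorMap (fun i => Φ i ∘ₗ Ψ i) = tensorMap Φ ∘ₗ tensorMap Ψ :=
  superOp_ext_tens fun X => by simp [tensorMap_tens]

theorem tensorMap_id [DecidableEq ι] [∀ i, Fintype (a i)] [∀ i, DecidableEq (a i)] :
    tensorMap (fun i => (LinearMap.id : SuperOp (a i) (a i))) = LinearMap.id :=
  superOp_ext_tens fun X => by simp [tensorMap_tens]

theorem posSemidef_tens [∀ i, Fintype (a i)] {P : ∀ i, Matrix (a i) (a i) ℂ}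
    (h : ∀ i, (P i).PosSemidef) : (tens P).PosSemidef := by
  classical
  choose B hB using fun i => exists_eq_conjTranspose_mul_self (h i)
  have : tens P = (tens B)ᴴ * tens B := by
    rw [tens_conjTranspose, ← tens_mul]
    exact congrArg tens (funext hB)
  rw [this]
  exact Matrix.posSemidef_conjTranspose_mul_self _

end Tensor

/-! ### Kraus operators and trace-nonincreasing maps -/

section Kraus

variable {a b c L : Type*} [Fintype L] [Fintype a]

/-- `T` is a family of Kraus operators of the map `Φ`. -/
def HasKraus (Φ : SuperOp a b) (T : L → Matrix b a ℂ) : Prop :=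
  ∀ X, Φ X = ∑ l, T l * X * (T l)ᴴ

theorem HasKraus.reindex {M : Type*} [Fintype M] {Φ : SuperOp a b} {T : L → Matrix b a ℂ}
    (h : HasKraus Φ T) (e : L ≃ M) : HasKraus Φ fun m => T (e.symm m) := fun X => by
  rw [h X, e.symm.sum_comp fun l => T l * X * (T l)ᴴ]

theorem HasKraus.ampliate_eq {r : Type*} [Fintype r] [DecidableEq r] {Φ : SuperOp a b}
    {T : L → Matrix b a ℂ} (h : HasKraus Φ T) (X : Matrix (r × a) (r × a) ℂ) :
    ampliate Φ X = ∑ l, Matrix.kronecker (1 : Matrix r r ℂ) (T l) * X *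
      (Matrix.kronecker (1 : Matrix r r ℂ) (T l))ᴴ := by
  ext ⟨p, y⟩ ⟨q, z⟩
  simp only [ampliate, Matrix.of_apply, h _, Matrix.sum_apply, Matrix.mul_apply,
    Matrix.conjTranspose_apply, Fintype.sum_prod_type, Matrix.kronecker, Matrix.kroneckerMap_apply,
    Matrix.one_apply]
  simp [apply_ite, Finset.sum_ite_irrel]

theorem HasKraus.isCompletelyPositive [Finite b] {Φ : SuperOp a b} {T : L → Matrix b a ℂ}
    (h : HasKraus Φ T) : IsCompletelyPositive Φ := by
  classical
  intro m X hX
  rw [h.ampliate_eq]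
  exact Matrix.posSemidef_sum _ fun l _ => hX.mul_mul_conjTranspose_same _

theorem HasKraus.comp {M : Type*} [Fintype M] [Fintype b] {Φ : SuperOp a b} {Ψ : SuperOp b c}
    {S : M → Matrix c b ℂ} {T : L → Matrix b a ℂ} (hΨ : HasKraus Ψ S) (hΦ : HasKraus Φ T) :
    HasKraus (Ψ ∘ₗ Φ) fun p : M × L => S p.1 * T p.2 := by
  intro X
  simp only [LinearMap.comp_apply, hΨ _, hΦ _, Fintype.sum_prod_type, Matrix.mul_sum,
    Matrix.sum_mul, Matrix.conjTranspose_mul, Matrix.mul_assoc]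

theorem HasKraus.tensorMap {ι : Type*} [Fintype ι] [DecidableEq ι] {a b L : ι → Type*}
    [∀ i, Fintype (a i)] [∀ i, DecidableEq (a i)] [∀ i, Fintype (L i)]
    {Φ : ∀ i, SuperOp (a i) (b i)} {T : ∀ i, L i → Matrix (b i) (a i) ℂ}
    (h : ∀ i, HasKraus (Φ i) (T i)) :
    HasKraus (tensorMap Φ) fun l : ∀ i, L i => tens fun i => T i (l i) := by
  let Ψ : SuperOp (∀ i, a i) (∀ i, b i) :=
    { toFun := fun X => ∑ l : ∀ i, L i, tens (fun i => T i (l i)) * X *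
        (tens fun i => T i (l i))ᴴ
      map_add' := fun X Y => by simp [Matrix.mul_add, Matrix.add_mul, Finset.sum_add_distrib]
      map_smul' := fun z X => by simp [Finset.smul_sum] }
  have : MultiuserQuantum.tensorMap Φ = Ψ := superOp_ext_tens fun X => by
    simp only [tensorMap_tens, h _ _, tens_sum, tens_mul, ← tens_conjTranspose]
    rfl
  intro X
  rw [this]
  rfl

/-- Choi's theorem: completely positive maps have Kraus operators. -/
theorem IsCompletelyPositive.exists_hasKraus [Fintype b] {Φ : SuperOp a b}
    (h : IsCompletelyPositive Φ) : ∃ (m : ℕ) (T : Fin m → Matrix b a ℂ), HasKraus Φ T := by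
  classical
  let e := Fintype.equivFin a
  -- The unnormalized maximally entangled vector, whose image is the Choi matrix. The ancilla is an
  -- enumerated copy of `a` because `IsCompletelyPositive` only tests ancillas `Fin m`. The
  -- conjugated rows of the factor `B` become the Kraus operators.
  let w : Fin (Fintype.card a) × a → ℂ := fun p => if e.symm p.1 = p.2 then 1 else 0
  have hC := h _ _ (Matrix.posSemidef_vecMulVec_self_star w)
  obtain ⟨B, hB⟩ := exists_eq_conjTranspose_mul_self hC
  have hs : ∀ (x x' : a) (y y' : b), Φ (Matrix.single x x' 1) y y' =
      ∑ l, star (B l (e x, y)) * B l (e x', y') := by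
    intro x x' y y'
    have := congrFun (congrFun hB (e x, y)) (e x', y')
    rw [Matrix.mul_apply] at this
    simp only [Matrix.conjTranspose_apply] at this
    rw [← this]
    simp only [ampliate, Matrix.of_apply]
    refine congrFun (congrFun (congrArg Φ ?_) y) y'
    ext z z'
    simp only [Matrix.single_apply, Matrix.of_apply, Matrix.vecMulVec_apply, w, Pi.star_apply,
      Equiv.symm_apply_apply]
    split_ifs <;> simp_all
  suffices hK : HasKraus Φ fun l => Matrix.of fun y x => star (B l (e x, y)) from
    ⟨_, _, hK.reindex (Fintype.equivFin _)⟩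
  intro X
  ext y y'
  conv_lhs => rw [Matrix.matrix_eq_sum_single X]
  rw [Matrix.sum_apply]
  simp only [map_sum, Matrix.sum_apply, Matrix.mul_apply, Matrix.conjTranspose_apply,
    Matrix.of_apply, star_star, Finset.sum_mul]
  have : ∀ x x', Φ (Matrix.single x x' (X x x')) y y' =
      ∑ l, star (B l (e x, y)) * X x x' * B l (e x', y') := by
    intro x x'
    have : Matrix.single x x' (X x x') = X x x' • Matrix.single x x' (1 : ℂ) := by simp
    rw [this, map_smul, Matrix.smul_apply, smul_eq_mul, hs, Finset.mul_sum]
    exact Finset.sum_congr rfl fun l _ => by ring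
  simp only [this]
  rw [Finset.sum_comm, Finset.sum_congr rfl fun x' _ => Finset.sum_comm, Finset.sum_comm]

/-- The operator inequality `∑ l, (T l)ᴴ * T l ≤ 1`. -/
def IsSubnormalized [Fintype b] [DecidableEq a] (T : L → Matrix b a ℂ) : Prop :=
  (1 - ∑ l, (T l)ᴴ * T l).PosSemidef

theorem HasKraus.trace_apply [Fintype b] {Φ : SuperOp a b} {T : L → Matrix b a ℂ}
    (h : HasKraus Φ T) (X : Matrix a a ℂ) :
    (Φ X).trace = ((∑ l, (T l)ᴴ * T l) * X).trace := by
  rw [h X, Matrix.trace_sum, Finset.sum_mul, Matrix.trace_sum]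
  exact Finset.sum_congr rfl fun l _ => by
    rw [Matrix.trace_mul_comm, Matrix.mul_assoc]

/-- Trace decrease on the rank-one operator `v vᴴ` is exactly the inequality of quadratic forms at
`v`. -/
theorem IsOperation.isSubnormalized [Fintype b] [DecidableEq a] {Φ : SuperOp a b}
    {T : L → Matrix b a ℂ} (hΦ : IsOperation Φ) (h : HasKraus Φ T) : IsSubnormalized T := by
  have hherm : (1 - ∑ l, (T l)ᴴ * T l).IsHermitian := by
    simp [Matrix.IsHermitian, Matrix.conjTranspose_sub, Matrix.conjTranspose_sum]
  refine Matrix.PosSemidef.of_dotProduct_mulVec_nonneg hherm fun v => ?_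
  have h1 := hΦ.trace_le _ (Matrix.posSemidef_vecMulVec_self_star v)
  rw [h.trace_apply, Matrix.mul_vecMulVec, Matrix.trace_vecMulVec, Matrix.trace_vecMulVec] at h1
  have him := hherm.im_star_dotProduct_mulVec_self v
  rw [Complex.nonneg_iff]
  refine ⟨?_, him.symm⟩
  rw [Matrix.sub_mulVec, Matrix.one_mulVec, dotProduct_sub, Complex.sub_re, dotProduct_comm,
    dotProduct_comm (star v)]
  linarith

theorem HasKraus.isOperation [Fintype b] [DecidableEq a] {Φ : SuperOp a b}
    {T : L → Matrix b a ℂ} (h : HasKraus Φ T) (hT : IsSubnormalized T) : IsOperation Φ := by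
  refine ⟨h.isCompletelyPositive, fun X hX => ?_⟩
  obtain ⟨B, rfl⟩ := exists_eq_conjTranspose_mul_self hX
  have h1 := (hT.mul_mul_conjTranspose_same B).trace_nonneg
  rw [h.trace_apply]
  rw [Matrix.mul_sub, Matrix.sub_mul, Matrix.trace_sub, Matrix.mul_one, sub_nonneg,
    Matrix.trace_mul_cycle, Matrix.trace_mul_comm B, Matrix.trace_mul_comm] at h1
  exact (Complex.le_def.1 h1).1

theorem IsSubnormalized.tens {ι : Type*} [Fintype ι] [DecidableEq ι] {a b L : ι → Type*}
    [∀ i, Fintype (a i)] [∀ i, DecidableEq (a i)] [∀ i, Fintype (b i)] [∀ i, Fintype (L i)]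
    {T : ∀ i, L i → Matrix (b i) (a i) ℂ} (h : ∀ i, IsSubnormalized (T i)) :
    IsSubnormalized fun l : ∀ i, L i => tens fun i => T i (l i) := by
  let P : ∀ i, Matrix (a i) (a i) ℂ := fun i => ∑ l, (T i l)ᴴ * T i l
  have hP : ∑ l : ∀ i, L i, (MultiuserQuantum.tens fun i => T i (l i))ᴴ *
      MultiuserQuantum.tens (fun i => T i (l i)) = MultiuserQuantum.tens P := by
    simp only [P, tens_sum, tens_mul, tens_conjTranspose]
  have hPpos : ∀ i, (P i).PosSemidef := fun i =>
    Matrix.posSemidef_sum _ fun l _ => Matrix.posSemidef_conjTranspose_mul_self _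
  -- Expanding `1 = ⨂ (P i + (1 - P i))` over all choices of summands exhibits `1 - ⨂ P i` as a sum
  -- of tensor products of positive operators.
  let C : (∀ _ : ι, Bool) → ∀ i, Matrix (a i) (a i) ℂ := fun t i => if t i then P i else 1 - P i
  have hsum : ∑ t : ∀ _ : ι, Bool, MultiuserQuantum.tens (C t) = 1 := by
    have := tens_sum fun i (t : Bool) => if t then P i else 1 - P i
    simp only [Fintype.sum_bool, if_true, Bool.false_eq_true, if_false, add_sub_cancel,
      tens_one] at this
    exact this.symm
  have hsplit := Finset.sum_erase_eq_sub (f := fun t => MultiuserQuantum.tens (C t))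
    (Finset.mem_univ fun _ : ι => true)
  rw [hsum] at hsplit
  have : MultiuserQuantum.tens (C fun _ => true) = MultiuserQuantum.tens P := by simp [C]
  rw [IsSubnormalized, hP, ← this, ← hsplit]
  refine Matrix.posSemidef_sum _ fun t _ => posSemidef_tens fun i => ?_
  by_cases ht : t i
  · simpa [C, ht] using hPpos i
  · have := h i
    rw [IsSubnormalized] at this
    simpa [C, ht] using this

end Kraus

theorem IsOperation.tensorMap {ι : Type*} [Fintype ι] [DecidableEq ι] {a b : ι → Type*}
    [∀ i, Fintype (a i)] [∀ i, DecidableEq (a i)] [∀ i, Fintype (b i)]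
    {Φ : ∀ i, SuperOp (a i) (b i)} (h : ∀ i, IsOperation (Φ i)) :
    IsOperation (tensorMap Φ) := by
  choose m T hT using fun i => (h i).completelyPositive.exists_hasKraus
  exact (HasKraus.tensorMap hT).isOperation
    (IsSubnormalized.tens fun i => (h i).isSubnormalized (hT i))

theorem IsCompletelyPositive.posSemidef_apply {a b : Type*} [Finite a] [Finite b] {Φ : SuperOp a b}
    (h : IsCompletelyPositive Φ) {X : Matrix a a ℂ} (hX : X.PosSemidef) : (Φ X).PosSemidef :=
  (h 1 _ (hX.submatrix Prod.snd)).submatrix fun y => ((0 : Fin 1), y)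

theorem IsOperation.comp {a b c : Type*} [Fintype a] [Fintype b] [Fintype c]
    {Ψ : SuperOp b c} {Φ : SuperOp a b} (hΨ : IsOperation Ψ) (hΦ : IsOperation Φ) :
    IsOperation (Ψ ∘ₗ Φ) :=
  ⟨fun m X hX => hΨ.completelyPositive m _ (hΦ.completelyPositive m X hX), fun X hX =>
    (hΨ.trace_le _ (hΦ.completelyPositive.posSemidef_apply hX)).trans (hΦ.trace_le X hX)⟩

theorem IsChannel.isOperation {a b : Type*} [Fintype a] [Fintype b] {Φ : SuperOp a b}
    (h : IsChannel Φ) : IsOperation Φ :=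
  ⟨h.completelyPositive, fun X _ => by rw [h.trace_eq]⟩

theorem isOperation_id {a : Type*} [Fintype a] : IsOperation (LinearMap.id : SuperOp a a) :=
  ⟨fun _ _ hX => hX, fun _ _ => le_rfl⟩

theorem isOperation_relabel {a b : Type*} [Fintype a] [Fintype b] (e : a ≃ b) :
    IsOperation (relabel e) := by
  refine ⟨fun m X hX => hX.submatrix fun p : Fin m × b => (p.1, e.symm p.2), fun X _ => ?_⟩
  simp only [relabel, Matrix.trace, LinearEquiv.coe_coe, Matrix.coe_reindexLinearEquiv,
    Matrix.reindex_apply, Matrix.diag_apply, Matrix.submatrix_apply]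
  rw [e.symm.sum_comp fun x => X x x]

end

end MultiuserQuantum

namespace MultiuserQuantum

/-! ### Continuity of the Shannon entropy under domination -/

section ShannonEntropy

open Real

theorem negMulLog_add_le {x y : ℝ} (hx : 0 ≤ x) (hy : 0 ≤ y) :
    negMulLog (x + y) ≤ negMulLog x + negMulLog y := by
  rcases hx.eq_or_lt with rfl | hx
  · simp
  rcases hy.eq_or_lt with rfl | hy
  · simp
  have h1 := log_le_log hx (by linarith : x ≤ x + y)
  have h2 := log_le_log hy (by linarith : y ≤ x + y)
  simp only [negMulLog]
  nlinarith [mul_le_mul_of_nonneg_left h1 hx.le, mul_le_mul_of_nonneg_left h2 hy.le]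

/-- `negMulLog` is not monotone on the unit interval; the possible decrease is at most `y - x`, from
`log (y / x) ≤ y / x - 1` and `log y ≤ 0`. -/
theorem negMulLog_sub_le {x y : ℝ} (hx : 0 ≤ x) (hxy : x ≤ y) (hy : y ≤ 1) :
    negMulLog x - (y - x) ≤ negMulLog y := by
  rcases hx.eq_or_lt with rfl | hx
  · have := negMulLog_nonneg hxy hy
    simp only [negMulLog_zero]
    linarith
  have hy0 := hx.trans_le hxy
  have h1 : log y ≤ log x + (y / x - 1) := by
    have := log_le_sub_one_of_pos (div_pos hy0 hx)
    rw [log_div hy0.ne' hx.ne'] at this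
    linarith
  have h2 : log y ≤ 0 := log_nonpos hy0.le hy
  have h3 : x * (y / x - 1) = y - x := by field_simp
  simp only [negMulLog]
  nlinarith [mul_le_mul_of_nonneg_left h1 hx.le]

/-- Jensen's inequality: for given total mass the uniform distribution maximizes the entropy. -/
theorem sum_negMulLog_le {ι : Type*} [Fintype ι] {p : ι → ℝ} (hp : ∀ i, 0 ≤ p i) :
    ∑ i, negMulLog (p i) ≤ negMulLog (∑ i, p i) + (∑ i, p i) * log (Fintype.card ι) := by
  rcases isEmpty_or_nonempty ι with h | h
  · simp
  have hN : (0 : ℝ) < Fintype.card ι := by exact_mod_cast Fintype.card_pos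
  have hJ := concaveOn_negMulLog.le_map_sum (t := Finset.univ) (p := p)
    (w := fun _ => (Fintype.card ι : ℝ)⁻¹) (fun _ _ => by positivity)
    (by simp) (fun i _ => hp i)
  simp only [smul_eq_mul, ← Finset.mul_sum] at hJ
  set q := ∑ i, p i with hq
  rcases (Finset.sum_nonneg fun i _ => hp i : 0 ≤ q).eq_or_lt with h0 | h0
  · have : ∀ i, p i = 0 := fun i =>
      (Finset.sum_eq_zero_iff_of_nonneg fun i _ => hp i).1 h0.symm i (Finset.mem_univ i)
    simp [hq, this]
  have h2 : negMulLog ((Fintype.card ι : ℝ)⁻¹ * q) =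
      (Fintype.card ι : ℝ)⁻¹ * (negMulLog q + q * log (Fintype.card ι)) := by
    simp only [negMulLog]
    rw [log_mul (by positivity) h0.ne', log_inv]
    ring
  rw [h2] at hJ
  exact le_of_mul_le_mul_left hJ (by positivity)

/-- If the list `c • q` is dominated by `p` in the sense of counting functions, where `p` and `q` are
probability distributions and `c` is close to one, then the entropies of `p` and `q` are close. -/
theorem abs_sum_negMulLog_sub_le {ι κ : Type*} [Fintype ι] [Fintype κ]
    {p : ι → ℝ} {q : κ → ℝ} (hp : ∀ i, 0 ≤ p i) (hq : ∀ j, 0 ≤ q j) (hp1 : ∑ i, p i = 1)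
    (hq1 : ∑ j, q j = 1) {c : ℝ} (hc : 0 < c) (hc1 : c ≤ 1)
    (h : ∀ t, 0 < t → Fintype.card {j // t ≤ c * q j} ≤ Fintype.card {i // t ≤ p i}) :
    |∑ j, negMulLog (q j) - ∑ i, negMulLog (p i)| ≤ negMulLog c + negMulLog (1 - c) +
      (1 - c) * (1 + log (Fintype.card ι) + log (Fintype.card κ)) := by
  classical
  -- Hall's marriage theorem matches each `q j > 0` with some `p i ≥ c * q j`. For a set `s`, the
  -- hypothesis at the threshold `c * q j₀`, with `q j₀` smallest in `s`, already provides enough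
  -- neighbours of `j₀` alone.
  obtain ⟨f, hf, hfp⟩ := (Finset.all_card_le_biUnion_card_iff_exists_injective
    fun j : {j // 0 < q j} => Finset.univ.filter fun i => c * q j ≤ p i).1 fun s => by
      rcases s.eq_empty_or_nonempty with rfl | hs
      · simp
      obtain ⟨j₀, hj₀, hmin⟩ := s.exists_min_image (fun j => q j) hs
      have h1 := h (c * q j₀) (mul_pos hc j₀.2)
      rw [Fintype.card_subtype, Fintype.card_subtype] at h1
      calc s.card = (s.map (Function.Embedding.subtype _)).card := (Finset.card_map _).symm
        _ ≤ _ := Finset.card_le_card fun j hj => by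
          obtain ⟨j', hj', rfl⟩ := Finset.mem_map.1 hj
          exact Finset.mem_filter.2
            ⟨Finset.mem_univ _, mul_le_mul_of_nonneg_left (hmin j' hj') hc.le⟩
        _ ≤ _ := h1
        _ ≤ _ := Finset.card_le_card
          (Finset.subset_biUnion_of_mem
            (fun j : {j // 0 < q j} => Finset.univ.filter fun i => c * q j ≤ p i) hj₀)
  -- The list `c • q` transported below `p`; the remainder `p - m` has total mass `1 - c`.
  let m : ι → ℝ := Function.extend f (fun j => c * q j) 0
  have hmf : ∀ j, m (f j) = c * q j := fun j => hf.extend_apply _ _ j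
  have hm0 : ∀ i, i ∉ Set.range f → m i = 0 := fun i hi =>
    Function.extend_apply' _ _ _ fun ⟨j, hj⟩ => hi ⟨j, hj⟩
  have hm : ∀ i, 0 ≤ m i ∧ m i ≤ p i := by
    intro i
    by_cases hi : i ∈ Set.range f
    · obtain ⟨j, rfl⟩ := hi
      rw [hmf]
      exact ⟨mul_nonneg hc.le (hq j), (Finset.mem_filter.1 (hfp j)).2⟩
    · rw [hm0 i hi]
      exact ⟨le_rfl, hp i⟩
  have hsum : ∀ g : ℝ → ℝ, g 0 = 0 → ∑ i, g (m i) = ∑ j, g (c * q j) := by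
    intro g hg
    rw [← Fintype.sum_of_injective f hf (fun j => g (c * q j)) (fun i => g (m i))
      (fun i hi => by rw [hm0 i hi, hg]) fun j => by rw [hmf]]
    refine Fintype.sum_of_injective Subtype.val Subtype.val_injective _ _ (fun j hj => ?_)
      fun j => rfl
    have : q j = 0 := by
      by_contra hne
      exact hj ⟨⟨j, (hq j).lt_of_ne' hne⟩, rfl⟩
    rw [this, mul_zero, hg]
  have hm1 : ∑ i, m i = c := by
    have := hsum id rfl
    simpa [← Finset.mul_sum, hq1] using this
  have hmH : ∑ i, negMulLog (m i) = c * ∑ j, negMulLog (q j) + negMulLog c := by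
    rw [hsum _ negMulLog_zero]
    simp only [negMulLog_mul, Finset.sum_add_distrib, ← Finset.mul_sum, ← Finset.sum_mul, hq1]
    ring
  have hp_le : ∀ i, p i ≤ 1 := fun i =>
    hp1 ▸ Finset.single_le_sum (fun i _ => hp i) (Finset.mem_univ i)
  have hq_le : ∀ j, q j ≤ 1 := fun j =>
    hq1 ▸ Finset.single_le_sum (fun i _ => hq i) (Finset.mem_univ j)
  have hd1 : ∑ i, (p i - m i) = 1 - c := by rw [Finset.sum_sub_distrib, hp1, hm1]
  have hupper : ∑ i, negMulLog (p i) ≤ ∑ i, negMulLog (m i) +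
      (negMulLog (1 - c) + (1 - c) * log (Fintype.card ι)) := by
    have h1 := sum_negMulLog_le (p := fun i => p i - m i) fun i => sub_nonneg.2 (hm i).2
    rw [hd1] at h1
    have h2 : ∑ i, negMulLog (p i) ≤ ∑ i, (negMulLog (m i) + negMulLog (p i - m i)) :=
      Finset.sum_le_sum fun i _ => by
        have := negMulLog_add_le (hm i).1 (sub_nonneg.2 (hm i).2)
        rwa [add_sub_cancel] at this
    rw [Finset.sum_add_distrib] at h2
    linarith
  have hlower : ∑ i, negMulLog (m i) - (1 - c) ≤ ∑ i, negMulLog (p i) := by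
    rw [← hd1, ← Finset.sum_sub_distrib]
    exact Finset.sum_le_sum fun i _ => negMulLog_sub_le (hm i).1 (hm i).2 (hp_le i)
  have hqH : ∑ j, negMulLog (q j) ≤ log (Fintype.card κ) := by
    simpa [hq1] using sum_negMulLog_le hq
  have hqH0 : 0 ≤ ∑ j, negMulLog (q j) :=
    Finset.sum_nonneg fun j _ => negMulLog_nonneg (hq j) (hq_le j)
  have hι : 0 ≤ log (Fintype.card ι) := log_natCast_nonneg _
  have hc0 := negMulLog_nonneg hc.le hc1
  have hc2 : 0 ≤ negMulLog (1 - c) := negMulLog_nonneg (by linarith) (by linarith)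
  have hc3 : 0 ≤ 1 - c := by linarith
  have e1 := mul_nonneg hc3 hι
  have e2 := mul_le_mul_of_nonneg_left hqH hc3
  have e3 := mul_nonneg hc3 hqH0
  rw [abs_le]
  constructor <;> nlinarith

end ShannonEntropy

/-! ### Eigenvalue counting under contractions -/

section Spectrum

theorem star_dotProduct_self {n : Type*} [Fintype n] (w : n → ℂ) :
    star w ⬝ᵥ w = ((∑ i, ‖w i‖ ^ 2 : ℝ) : ℂ) := by
  simp only [dotProduct, Pi.star_apply, Complex.ofReal_sum, Complex.ofReal_pow,
    ← Complex.conj_mul', RCLike.star_def]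

theorem star_dotProduct_diagonal_mulVec {n : Type*} [Fintype n] [DecidableEq n] (d : n → ℝ)
    (w : n → ℂ) : star w ⬝ᵥ (Matrix.diagonal (fun i => (d i : ℂ)) *ᵥ w) =
      ((∑ i, d i * ‖w i‖ ^ 2 : ℝ) : ℂ) := by
  simp only [dotProduct, Matrix.mulVec_diagonal, Pi.star_apply, Complex.ofReal_sum,
    Complex.ofReal_mul, Complex.ofReal_pow, ← Complex.mul_conj', RCLike.star_def]
  exact Finset.sum_congr rfl fun i _ => by ring

variable {a b : Type*} [Fintype a] [Fintype b] [DecidableEq a] [DecidableEq b]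

/-- A min-max argument by dimension count in the eigenbases of `ρ` and `σ`, where `K` becomes the
contraction `N`. -/
theorem card_eigenvalues_ge_le {ρ : Matrix a a ℂ} {σ : Matrix b b ℂ} (hρ : ρ.IsHermitian)
    (hσ : σ.IsHermitian) {K : Matrix a b ℂ} (hK : (1 - Kᴴ * K).PosSemidef) {c : ℝ}
    (h : (c : ℂ) • σ = Kᴴ * ρ * K) {t : ℝ} (ht : 0 < t) :
    Fintype.card {j // t ≤ c * hσ.eigenvalues j} ≤ Fintype.card {i // t ≤ hρ.eigenvalues i} := by
  let U : Matrix a a ℂ := hρ.eigenvectorUnitary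
  let V : Matrix b b ℂ := hσ.eigenvectorUnitary
  have hU1 : U * Uᴴ = 1 := Matrix.mem_unitaryGroup_iff.1 hρ.eigenvectorUnitary.2
  have hV1 : Vᴴ * V = 1 := Matrix.mem_unitaryGroup_iff'.1 hσ.eigenvectorUnitary.2
  have hρU : ρ = U * Matrix.diagonal (fun i => (hρ.eigenvalues i : ℂ)) * Uᴴ := hρ.spectral_theorem
  have hσV : σ = V * Matrix.diagonal (fun i => (hσ.eigenvalues i : ℂ)) * Vᴴ := hσ.spectral_theorem
  let N : Matrix a b ℂ := Uᴴ * K * V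
  have hN : (1 - Nᴴ * N).PosSemidef := by
    have h1 : 1 - Nᴴ * N = Vᴴ * (1 - Kᴴ * K) * Vᴴᴴ := by
      have : Nᴴ * N = Vᴴ * (Kᴴ * (U * Uᴴ) * K) * V := by
        simp only [N, Matrix.conjTranspose_mul, Matrix.conjTranspose_conjTranspose,
          Matrix.mul_assoc]
      rw [this, hU1, Matrix.mul_one, Matrix.conjTranspose_conjTranspose, Matrix.mul_sub,
        Matrix.sub_mul, Matrix.mul_one, hV1]
    rw [h1]
    exact hK.mul_mul_conjTranspose_same _
  have hdiag : (c : ℂ) • Matrix.diagonal (fun i => (hσ.eigenvalues i : ℂ)) =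
      Nᴴ * Matrix.diagonal (fun i => (hρ.eigenvalues i : ℂ)) * N := by
    have h1 : Nᴴ * Matrix.diagonal (fun i => (hρ.eigenvalues i : ℂ)) * N =
        Vᴴ * (Kᴴ * (U * Matrix.diagonal (fun i => (hρ.eigenvalues i : ℂ)) * Uᴴ) * K) * V := by
      simp only [N, Matrix.conjTranspose_mul, Matrix.conjTranspose_conjTranspose,
        Matrix.mul_assoc]
    rw [h1, ← hρU, ← h]
    simp only [Matrix.mul_smul, Matrix.smul_mul]
    congr 1
    conv_rhs => rw [hσV]
    rw [Matrix.mul_assoc, Matrix.mul_assoc, hV1, ← Matrix.mul_assoc, ← Matrix.mul_assoc, hV1]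
    simp
  have hquad : ∀ v : b → ℂ, ∑ j, c * hσ.eigenvalues j * ‖v j‖ ^ 2 =
      ∑ i, hρ.eigenvalues i * ‖(N *ᵥ v) i‖ ^ 2 := by
    intro v
    have h1 := congrArg (fun M => star v ⬝ᵥ (M *ᵥ v)) hdiag
    have h2 : (c : ℂ) • Matrix.diagonal (fun i => (hσ.eigenvalues i : ℂ)) =
        Matrix.diagonal (fun i => ((c * hσ.eigenvalues i : ℝ) : ℂ)) := by
      rw [← Matrix.diagonal_smul]
      congr 1
      ext i
      simp
    simp only [h2] at h1
    rw [star_dotProduct_diagonal_mulVec, ← Matrix.mulVec_mulVec, ← Matrix.mulVec_mulVec, Matrix.dotProduct_mulVec,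
      Matrix.vecMul_conjTranspose, star_star, star_dotProduct_diagonal_mulVec] at h1
    exact_mod_cast h1
  have hcontr : ∀ v : b → ℂ, ∑ i, ‖(N *ᵥ v) i‖ ^ 2 ≤ ∑ j, ‖v j‖ ^ 2 := by
    intro v
    have h1 := hN.dotProduct_mulVec_nonneg v
    rw [Matrix.sub_mulVec, Matrix.one_mulVec, ← Matrix.mulVec_mulVec, dotProduct_sub,
      Matrix.dotProduct_mulVec _ Nᴴ, Matrix.vecMul_conjTranspose, star_star, sub_nonneg] at h1
    rw [star_dotProduct_self, star_dotProduct_self] at h1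
    exact_mod_cast h1
  let ext₀ : ({j // t ≤ c * hσ.eigenvalues j} → ℂ) →ₗ[ℂ] b → ℂ :=
    { toFun := fun α j => if hj : t ≤ c * hσ.eigenvalues j then α ⟨j, hj⟩ else 0
      map_add' := fun α β => by ext j; by_cases hj : t ≤ c * hσ.eigenvalues j <;> simp [hj]
      map_smul' := fun z α => by ext j; by_cases hj : t ≤ c * hσ.eigenvalues j <;> simp [hj] }
  -- If `v` is supported on the eigenvalues with `c σⱼ ≥ t` and `N v` vanishes wherever `ρᵢ ≥ t`,
  -- then `t ‖v‖² ≤ ∑ ρᵢ |(N v)ᵢ|² ≤ t ‖N v‖² ≤ t ‖v‖²`. The middle inequality is strict unless `N v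
  -- = 0`, so `N v = 0` and then `v = 0`.
  let L : ({j // t ≤ c * hσ.eigenvalues j} → ℂ) →ₗ[ℂ] ({i // t ≤ hρ.eigenvalues i} → ℂ) :=
    (LinearMap.funLeft ℂ ℂ Subtype.val) ∘ₗ N.mulVecLin ∘ₗ ext₀
  have hL : Function.Injective L := by
    rw [← LinearMap.ker_eq_bot, LinearMap.ker_eq_bot']
    intro α hα
    set v := ext₀ α with hv
    have hNv : ∀ i, t ≤ hρ.eigenvalues i → (N *ᵥ v) i = 0 := fun i hi =>
      congrFun hα ⟨i, hi⟩
    have hv0 : ∀ j, ¬ t ≤ c * hσ.eigenvalues j → v j = 0 := fun j hj => dif_neg hj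
    have h1 : t * ∑ j, ‖v j‖ ^ 2 ≤ ∑ j, c * hσ.eigenvalues j * ‖v j‖ ^ 2 := by
      rw [Finset.mul_sum]
      refine Finset.sum_le_sum fun j _ => ?_
      by_cases hj : t ≤ c * hσ.eigenvalues j
      · exact mul_le_mul_of_nonneg_right hj (by positivity)
      · simp [hv0 j hj]
    have h2 : ∀ i, hρ.eigenvalues i * ‖(N *ᵥ v) i‖ ^ 2 ≤ t * ‖(N *ᵥ v) i‖ ^ 2 := by
      intro i
      by_cases hi : t ≤ hρ.eigenvalues i
      · simp [hNv i hi]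
      · exact mul_le_mul_of_nonneg_right (not_le.1 hi).le (by positivity)
    have h3 : ∀ i, (N *ᵥ v) i = 0 := by
      by_contra! hne
      obtain ⟨i₀, hi₀⟩ := hne
      have hi₁ : hρ.eigenvalues i₀ < t := by
        by_contra hlt
        exact hi₀ (hNv i₀ (not_lt.1 hlt))
      have h4 : ∑ i, hρ.eigenvalues i * ‖(N *ᵥ v) i‖ ^ 2 < ∑ i, t * ‖(N *ᵥ v) i‖ ^ 2 :=
        Finset.sum_lt_sum (fun i _ => h2 i) ⟨i₀, Finset.mem_univ _,
          mul_lt_mul_of_pos_right hi₁ (by positivity)⟩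
      rw [← hquad, ← Finset.mul_sum] at h4
      have := mul_le_mul_of_nonneg_left (hcontr v) ht.le
      linarith
    have h5 : ∑ j, ‖v j‖ ^ 2 ≤ 0 := by
      have : ∑ j, c * hσ.eigenvalues j * ‖v j‖ ^ 2 = 0 := by
        rw [hquad]
        simp [h3]
      rw [this] at h1
      exact nonpos_of_mul_nonpos_right h1 ht
    have h6 := (Finset.sum_eq_zero_iff_of_nonneg fun j _ => by positivity).1
      (h5.antisymm (Finset.sum_nonneg fun j _ => by positivity))
    ext j
    have h7 : v j.1 = 0 := by simpa using h6 j.1 (Finset.mem_univ _)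
    rw [← show v j.1 = α j from dif_pos j.2, h7]
    rfl
  simpa using LinearMap.finrank_le_finrank_of_injective hL

end Spectrum

/-! ### Entropy of reduced states -/

section PureState

variable {r r' a b : Type*} [Fintype r] [Fintype r'] [Fintype a] [Fintype b]

theorem PureState.trace_reduced (Ψ : PureState r a) : Ψ.reduced.trace = 1 := by
  have h := Ψ.norm_one
  rw [Fintype.sum_prod_type, Finset.sum_comm] at h
  simp only [Matrix.trace, Matrix.diag_apply, PureState.reduced, Matrix.of_apply,
    RCLike.star_def, Complex.mul_conj']
  exact_mod_cast h

theorem PureState.sum_eigenvalues [DecidableEq a] (Ψ : PureState r a) :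
    ∑ x, Ψ.reduced_posSemidef.1.eigenvalues x = 1 := by
  have h1 := Ψ.reduced_posSemidef.1.trace_eq_sum_eigenvalues
  rw [Ψ.trace_reduced, ← RCLike.ofReal_sum] at h1
  exact (RCLike.ofReal_injective (K := ℂ) (by simpa using h1)).symm

theorem PureState.entropy_eq [DecidableEq a] (Ψ : PureState r a) : Ψ.entropy =
    (∑ x, Real.negMulLog (Ψ.reduced_posSemidef.1.eigenvalues x)) / Real.log 2 := by
  simp only [PureState.entropy, Real.negMulLog, Real.logb, Finset.sum_div,
    ← Finset.sum_neg_distrib]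
  exact Finset.sum_congr rfl fun x _ => by ring

theorem PureState.abs_entropy_sub_le [DecidableEq a] [DecidableEq b] (Ψ : PureState r a)
    (Φ : PureState r' b) {K : Matrix a b ℂ} (hK : (1 - Kᴴ * K).PosSemidef) {c : ℝ} (hc : 0 < c)
    (hc1 : c ≤ 1) (h : (c : ℂ) • Φ.reduced = Kᴴ * Ψ.reduced * K) :
    |Φ.entropy - Ψ.entropy| ≤ (Real.negMulLog c + Real.negMulLog (1 - c) +
      (1 - c) * (1 + Real.log (Fintype.card a) + Real.log (Fintype.card b))) / Real.log 2 := by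
  have h2 : 0 < Real.log 2 := Real.log_pos one_lt_two
  rw [Ψ.entropy_eq, Φ.entropy_eq, ← sub_div, abs_div, abs_of_pos h2]
  gcongr
  exact abs_sum_negMulLog_sub_le Ψ.reduced_posSemidef.eigenvalues_nonneg
    Φ.reduced_posSemidef.eigenvalues_nonneg Ψ.sum_eigenvalues Φ.sum_eigenvalues hc hc1
    fun t ht => card_eigenvalues_ge_le _ _ hK h ht

end PureState

end MultiuserQuantum

namespace MultiuserQuantum

noncomputable section

/-! ### Bipartite vectors as matrices, and contractions -/

section Vec

variable {r a b L : Type*}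

/-- A matrix, seen as a vector of `ℂ^r ⊗ ℂ^a`.  The operator `1 ⊗ T` maps `vec M` to
`vec (M * Tᵀ)`. -/
def vec (M : Matrix r a ℂ) : EuclideanSpace ℂ (r × a) := WithLp.toLp 2 fun p => M p.1 p.2

theorem vec_add (M N : Matrix r a ℂ) : vec (M + N) = vec M + vec N := rfl

theorem vec_sub (M N : Matrix r a ℂ) : vec (M - N) = vec M - vec N := rfl

theorem vec_smul (z : ℂ) (M : Matrix r a ℂ) : vec (z • M) = z • vec M := rfl

theorem vec_sum [Fintype L] (M : L → Matrix r a ℂ) : vec (∑ l, M l) = ∑ l, vec (M l) :=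
  map_sum (⟨⟨vec, rfl⟩, vec_add⟩ : Matrix r a ℂ →+ EuclideanSpace ℂ (r × a)) _ _

variable [Fintype r] [Fintype a] [Fintype b] [Fintype L]

theorem inner_vec (M N : Matrix r a ℂ) : inner ℂ (vec M) (vec N) = (Mᴴ * N).trace := by
  simp only [vec, PiLp.inner_apply, Fintype.sum_prod_type, Matrix.trace, Matrix.diag_apply,
    Matrix.mul_apply, Matrix.conjTranspose_apply, RCLike.inner_apply, RCLike.star_def]
  rw [Finset.sum_comm]
  exact Finset.sum_congr rfl fun _ _ => Finset.sum_congr rfl fun _ _ => mul_comm _ _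

theorem trace_mul_conjTranspose_self (M : Matrix r a ℂ) :
    (M * Mᴴ).trace = ((‖vec M‖ ^ 2 : ℝ) : ℂ) := by
  rw [Matrix.trace_mul_comm, ← inner_vec, inner_self_eq_norm_sq_to_K]
  simp

theorem norm_vec_sq (M : Matrix r a ℂ) : ‖vec M‖ ^ 2 = ∑ j, ∑ x, ‖M j x‖ ^ 2 := by
  simp [EuclideanSpace.norm_sq_eq, vec, Fintype.sum_prod_type]

theorem inner_vec_mul_transpose_left (M : Matrix r b ℂ) (N : Matrix r a ℂ) (K : Matrix b a ℂ) :
    inner ℂ (vec M) (vec (N * Kᵀ)) = inner ℂ (vec (M * Kᴴᵀ)) (vec N) := by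
  have h : Kᴴᵀᴴ = Kᵀ := by
    ext
    simp
  rw [inner_vec, inner_vec, ← Matrix.mul_assoc, Matrix.trace_mul_comm, ← Matrix.mul_assoc,
    Matrix.conjTranspose_mul, h]

/-- A matrix element of `1 ⊗ K` depends on the two vectors only through `Mᴴ * N`; this is what makes
partial contractions of `K` computable. -/
theorem inner_vec_mul_transpose (M : Matrix r b ℂ) (N : Matrix r a ℂ) (K : Matrix b a ℂ) :
    inner ℂ (vec M) (vec (N * Kᵀ)) = ∑ x, ∑ y, (Mᴴ * N) x y * K x y := by
  rw [inner_vec, ← Matrix.mul_assoc]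
  rfl

theorem IsSubnormalized.sum_norm_vec_sq_le [DecidableEq a] {T : L → Matrix b a ℂ}
    (hT : IsSubnormalized T) (M : Matrix r a ℂ) :
    ∑ l, ‖vec (M * (T l)ᵀ)‖ ^ 2 ≤ ‖vec M‖ ^ 2 := by
  have h1 := (hT.transpose.mul_mul_conjTranspose_same M).trace_nonneg
  have h2 : M * (1 - ∑ l, (T l)ᴴ * T l)ᵀ * Mᴴ =
      M * Mᴴ - ∑ l, (M * (T l)ᵀ) * (M * (T l)ᵀ)ᴴ := by
    simp only [Matrix.transpose_sub, Matrix.transpose_one, Matrix.mul_sub, Matrix.sub_mul,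
      Matrix.mul_one, Matrix.transpose_sum, Matrix.mul_sum, Matrix.sum_mul, Matrix.transpose_mul,
      Matrix.conjTranspose_mul, Matrix.mul_assoc]
    rfl
  rw [h2, Matrix.trace_sub, Matrix.trace_sum, sub_nonneg] at h1
  simp only [trace_mul_conjTranspose_self] at h1
  exact_mod_cast h1

/-- A linear combination of Kraus operators with square-summable coefficients. -/
theorem sq_norm_inner_vec_sum_le (T : L → Matrix b a ℂ) {α : L → ℂ} (hα : ∑ l, ‖α l‖ ^ 2 ≤ 1)
    (M : Matrix r b ℂ) (N : Matrix r a ℂ) :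
    ‖inner ℂ (vec M) (vec (N * (∑ l, α l • T l)ᵀ))‖ ^ 2 ≤
      ∑ l, ‖inner ℂ (vec M) (vec (N * (T l)ᵀ))‖ ^ 2 := by
  have h1 : inner ℂ (vec M) (vec (N * (∑ l, α l • T l)ᵀ)) =
      ∑ l, α l * inner ℂ (vec M) (vec (N * (T l)ᵀ)) := by
    simp only [Matrix.transpose_sum, Matrix.mul_sum, vec_sum, inner_sum, Matrix.transpose_smul,
      Matrix.mul_smul, vec_smul, inner_smul_right]
  rw [h1]
  calc _ ≤ (∑ l, ‖α l‖ * ‖inner ℂ (vec M) (vec (N * (T l)ᵀ))‖) ^ 2 := by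
        gcongr
        refine (norm_sum_le _ _).trans_eq ?_
        simp only [norm_mul]
    _ ≤ (∑ l, ‖α l‖ ^ 2) * ∑ l, ‖inner ℂ (vec M) (vec (N * (T l)ᵀ))‖ ^ 2 :=
        Finset.sum_mul_sq_le_sq_mul_sq _ _ _
    _ ≤ _ := mul_le_of_le_one_left (Finset.sum_nonneg fun _ _ => by positivity) hα

theorem IsSubnormalized.norm_inner_vec_le [DecidableEq a] {T : L → Matrix b a ℂ}
    (hT : IsSubnormalized T) {α : L → ℂ} (hα : ∑ l, ‖α l‖ ^ 2 ≤ 1)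
    (M : Matrix r b ℂ) (N : Matrix r a ℂ) :
    ‖inner ℂ (vec M) (vec (N * (∑ l, α l • T l)ᵀ))‖ ≤ ‖vec M‖ * ‖vec N‖ := by
  refine le_of_sq_le_sq ((sq_norm_inner_vec_sum_le T hα M N).trans ?_) (by positivity)
  calc _ ≤ ∑ l, ‖vec M‖ ^ 2 * ‖vec (N * (T l)ᵀ)‖ ^ 2 := by
        refine Finset.sum_le_sum fun l _ => ?_
        rw [← mul_pow]
        gcongr
        exact norm_inner_le_norm _ _
    _ ≤ _ := by
        rw [← Finset.mul_sum, mul_pow]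
        gcongr
        exact hT.sum_norm_vec_sq_le N

theorem norm_vec_mul_transpose_le {K : Matrix b a ℂ}
    (hK : ∀ (M : Matrix r b ℂ) (N : Matrix r a ℂ),
      ‖inner ℂ (vec M) (vec (N * Kᵀ))‖ ≤ ‖vec M‖ * ‖vec N‖) (N : Matrix r a ℂ) :
    ‖vec (N * Kᵀ)‖ ≤ ‖vec N‖ := by
  have h := hK (N * Kᵀ) N
  rw [inner_self_eq_norm_sq_to_K, norm_pow, RCLike.norm_ofReal, abs_norm, sq] at h
  rcases (norm_nonneg (vec (N * Kᵀ))).eq_or_lt with h0 | h0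
  · rw [← h0]
    exact norm_nonneg _
  · exact le_of_mul_le_mul_left h h0

theorem norm_inner_vec_conjTranspose_le {K : Matrix b a ℂ}
    (hK : ∀ (M : Matrix r b ℂ) (N : Matrix r a ℂ),
      ‖inner ℂ (vec M) (vec (N * Kᵀ))‖ ≤ ‖vec M‖ * ‖vec N‖) (M : Matrix r a ℂ)
    (N : Matrix r b ℂ) : ‖inner ℂ (vec M) (vec (N * Kᴴᵀ))‖ ≤ ‖vec M‖ * ‖vec N‖ := by
  rw [inner_vec_mul_transpose_left, Matrix.conjTranspose_conjTranspose, norm_inner_symm, mul_comm]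
  exact hK N M

theorem posSemidef_one_sub_conjTranspose_mul [Nonempty r] [DecidableEq a] {K : Matrix b a ℂ}
    (hK : ∀ (M : Matrix r b ℂ) (N : Matrix r a ℂ),
      ‖inner ℂ (vec M) (vec (N * Kᵀ))‖ ≤ ‖vec M‖ * ‖vec N‖) :
    (1 - Kᴴ * K).PosSemidef := by
  classical
  refine Matrix.PosSemidef.of_dotProduct_mulVec_nonneg
    (by simp [Matrix.IsHermitian, Matrix.conjTranspose_sub]) fun v => ?_
  obtain ⟨j₀⟩ := ‹Nonempty r›
  -- The product vector of a reference basis vector and `v`; a nonempty reference is needed here.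
  let N : Matrix r a ℂ := Matrix.of fun j x => if j = j₀ then v x else 0
  have h1 := norm_vec_mul_transpose_le hK N
  have h2 : ‖vec N‖ ^ 2 = ∑ x, ‖v x‖ ^ 2 := by
    rw [norm_vec_sq, Finset.sum_eq_single j₀ (fun j _ hj => by simp [N, hj]) (by simp)]
    simp [N]
  have h3 : ‖vec (N * Kᵀ)‖ ^ 2 = ∑ x, ‖(K *ᵥ v) x‖ ^ 2 := by
    rw [norm_vec_sq, Finset.sum_eq_single j₀
      (fun j _ hj => by simp [N, hj, Matrix.mul_apply]) (by simp)]
    simp [N, Matrix.mul_apply, Matrix.mulVec, dotProduct, mul_comm]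
  rw [Matrix.sub_mulVec, Matrix.one_mulVec, ← Matrix.mulVec_mulVec, dotProduct_sub,
    Matrix.dotProduct_mulVec _ Kᴴ, Matrix.vecMul_conjTranspose, star_star, sub_nonneg,
    star_dotProduct_self, star_dotProduct_self, ← h2, ← h3]
  exact_mod_cast pow_le_pow_left₀ (norm_nonneg _) h1 2

end Vec

/-! ### Local operators obtained from a joint operator -/

section TensorVec

variable {ι : Type*} [Fintype ι] [DecidableEq ι] {r a b : ι → Type*} [∀ i, Fintype (r i)]
  [∀ i, Fintype (a i)] [∀ i, Fintype (b i)]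

theorem trace_tens (M : ∀ i, Matrix (a i) (a i) ℂ) : (tens M).trace = ∏ i, (M i).trace := by
  simp only [Matrix.trace, Matrix.diag_apply, tens_apply, Fintype.prod_sum]

theorem inner_vec_tens (M N : ∀ i, Matrix (r i) (a i) ℂ) :
    inner ℂ (vec (tens M)) (vec (tens N)) = ∏ i, inner ℂ (vec (M i)) (vec (N i)) := by
  simp only [inner_vec, tens_conjTranspose, ← tens_mul, trace_tens]

theorem norm_vec_tens (M : ∀ i, Matrix (r i) (a i) ℂ) :
    ‖vec (tens M)‖ = ∏ i, ‖vec (M i)‖ := by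
  have h := inner_vec_tens M M
  simp only [inner_self_eq_norm_sq_to_K] at h
  have h2 : ‖vec (tens M)‖ ^ 2 = (∏ i, ‖vec (M i)‖) ^ 2 := by
    rw [← Finset.prod_pow]
    exact Complex.ofReal_injective (by simpa using h)
  exact (pow_left_inj₀ (norm_nonneg _) (Finset.prod_nonneg fun _ _ => norm_nonneg _)
    two_ne_zero).1 h2

/-- The operator on the `i`-th factor that is obtained from a joint operator `K` by contracting all
other factors with the matrices `ω j`. -/
def localOp (K : Matrix (∀ i, a i) (∀ i, b i) ℂ) (ω : ∀ i, Matrix (a i) (b i) ℂ) (i : ι) :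
    Matrix (a i) (b i) ℂ :=
  open Classical in
  Matrix.of fun x y => ∑ X : ∀ i, a i, ∑ Y : ∀ i, b i, if X i = x then if Y i = y then
    K X Y * ∏ j ∈ Finset.univ.erase i, ω j (X j) (Y j) else 0 else 0

theorem sum_mul_localOp (K : Matrix (∀ i, a i) (∀ i, b i) ℂ) (ω : ∀ i, Matrix (a i) (b i) ℂ)
    (i : ι) (z : Matrix (a i) (b i) ℂ) :
    ∑ x, ∑ y, z x y * localOp K ω i x y =
      ∑ X, ∑ Y, tens (Function.update ω i z) X Y * K X Y := by
  classical
  have h1 : ∀ X Y, tens (Function.update ω i z) X Y * K X Y =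
      ∑ x, ∑ y, z x y * if X i = x then if Y i = y then
        K X Y * ∏ j ∈ Finset.univ.erase i, ω j (X j) (Y j) else 0 else 0 := by
    intro X Y
    have h2 : ∏ j ∈ Finset.univ.erase i, Function.update ω i z j (X j) (Y j) =
        ∏ j ∈ Finset.univ.erase i, ω j (X j) (Y j) :=
      Finset.prod_congr rfl fun j hj => by
        rw [Function.update_of_ne (Finset.ne_of_mem_erase hj)]
    rw [tens_apply, ← Finset.mul_prod_erase _ _ (Finset.mem_univ i), h2, Function.update_self]
    simp only [mul_ite, mul_zero, Finset.sum_ite_irrel, Finset.sum_ite_eq, Finset.mem_univ,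
      if_true, Finset.sum_const_zero]
    ring
  simp only [h1, localOp, Matrix.of_apply, Finset.mul_sum]
  calc _ = ∑ x, ∑ X, ∑ Y, ∑ y, _ := Finset.sum_congr rfl fun x _ => by
        rw [Finset.sum_comm]
        exact Finset.sum_congr rfl fun X _ => Finset.sum_comm
    _ = ∑ X, ∑ x, ∑ Y, ∑ y, _ := Finset.sum_comm
    _ = _ := Finset.sum_congr rfl fun X _ => Finset.sum_comm

/-- Contracting factor `j` with `(M j)ᴴ * N j` freezes its input at `N j` and its output at `M j`.
With unit vectors frozen, contractivity passes from `K` to the local operator. -/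
theorem inner_vec_localOp (K : Matrix (∀ i, a i) (∀ i, b i) ℂ) (M : ∀ i, Matrix (r i) (a i) ℂ)
    (N : ∀ i, Matrix (r i) (b i) ℂ) (i : ι) (M' : Matrix (r i) (a i) ℂ)
    (N' : Matrix (r i) (b i) ℂ) :
    inner ℂ (vec M') (vec (N' * (localOp K (fun j => (M j)ᴴ * N j) i)ᵀ)) =
      inner ℂ (vec (tens (Function.update M i M')))
        (vec (tens (Function.update N i N') * Kᵀ)) := by
  rw [inner_vec_mul_transpose, inner_vec_mul_transpose, sum_mul_localOp, tens_conjTranspose,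
    ← tens_mul]
  have : Function.update (fun j => (M j)ᴴ * N j) i (M'ᴴ * N') =
      fun j => (Function.update M i M' j)ᴴ * Function.update N i N' j := by
    ext j : 1
    rcases eq_or_ne j i with rfl | hj
    · simp
    · simp [Function.update_of_ne hj]
  rw [this]

theorem norm_vec_tens_update {M : ∀ i, Matrix (r i) (a i) ℂ} (h : ∀ i, ‖vec (M i)‖ = 1)
    {i : ι} (M' : Matrix (r i) (a i) ℂ) : ‖vec (tens (Function.update M i M'))‖ = ‖vec M'‖ := by
  rw [norm_vec_tens, ← Finset.mul_prod_erase _ _ (Finset.mem_univ i), Function.update_self,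
    Finset.prod_eq_one, mul_one]
  intro j hj
  rw [Function.update_of_ne (Finset.ne_of_mem_erase hj), h j]

theorem norm_inner_vec_localOp_le {K : Matrix (∀ i, a i) (∀ i, b i) ℂ}
    (hK : ∀ (M : Matrix (∀ i, r i) (∀ i, a i) ℂ) (N : Matrix (∀ i, r i) (∀ i, b i) ℂ),
      ‖inner ℂ (vec M) (vec (N * Kᵀ))‖ ≤ ‖vec M‖ * ‖vec N‖)
    {M : ∀ i, Matrix (r i) (a i) ℂ} {N : ∀ i, Matrix (r i) (b i) ℂ}
    (hM : ∀ i, ‖vec (M i)‖ = 1) (hN : ∀ i, ‖vec (N i)‖ = 1) (i : ι)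
    (M' : Matrix (r i) (a i) ℂ) (N' : Matrix (r i) (b i) ℂ) :
    ‖inner ℂ (vec M') (vec (N' * (localOp K (fun j => (M j)ᴴ * N j) i)ᵀ))‖ ≤
      ‖vec M'‖ * ‖vec N'‖ := by
  rw [inner_vec_localOp, ← norm_vec_tens_update hM M', ← norm_vec_tens_update hN N']
  exact hK _ _

end TensorVec

/-! ### Fidelity as a sum of squared amplitudes -/

section Fidelity

variable {k : ℕ} {r a b : Fin k → Type*} [∀ i, Fintype (r i)] [∀ i, Fintype (a i)]
  [∀ i, Fintype (b i)]

/-- The amplitudes of a bipartite pure state as a matrix. -/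
def PureState.mat {r a : Type*} [Fintype r] [Fintype a] (Ψ : PureState r a) : Matrix r a ℂ :=
  Matrix.of fun j x => Ψ.amp (j, x)

theorem PureState.norm_vec_mat {r a : Type*} [Fintype r] [Fintype a] (Ψ : PureState r a) :
    ‖vec Ψ.mat‖ = 1 := by
  have h := Ψ.norm_one
  rw [Fintype.sum_prod_type] at h
  rw [← pow_left_inj₀ (norm_nonneg _) zero_le_one two_ne_zero, norm_vec_sq, one_pow]
  exact h

/-- The bipartite pure state with a given matrix of amplitudes. -/
def PureState.ofMat {r a : Type*} [Fintype r] [Fintype a] (M : Matrix r a ℂ)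
    (h : ‖vec M‖ = 1) : PureState r a where
  amp p := M p.1 p.2
  norm_one := by
    have h' := norm_vec_sq M
    rw [h, one_pow] at h'
    rw [Fintype.sum_prod_type]
    exact h'.symm

/-- Each Kraus operator sends the pure state to a pure vector, so each contributes one squared
transition amplitude. -/
theorem entanglementFidelity_eq_sum {L : Type*} [Fintype L] (Ψ : ∀ i, PureState (r i) (a i))
    {Φ : SuperOp (∀ i, a i) (∀ i, a i)} {T : L → Matrix (∀ i, a i) (∀ i, a i) ℂ}
    (h : HasKraus Φ T) :
    entanglementFidelity Ψ Φ = ∑ l, ‖inner ℂ (vec (tens fun i => (Ψ i).mat))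
      (vec ((tens fun i => (Ψ i).mat) * (T l)ᵀ))‖ ^ 2 := by
  set P := tens fun i => (Ψ i).mat with hP
  let v : (∀ i, r i) × (∀ i, a i) → ℂ := fun p => P p.1 p.2
  let w : L → (∀ i, r i) × (∀ i, a i) → ℂ := fun l p => (P * (T l)ᵀ) p.1 p.2
  have h1 : ampliate Φ (Matrix.vecMulVec v (star v)) =
      ∑ l, Matrix.vecMulVec (w l) (star (w l)) := by
    ext ⟨p, y⟩ ⟨q, z⟩
    simp only [ampliate, Matrix.of_apply, h _, Matrix.sum_apply, Matrix.vecMulVec_apply,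
      Pi.star_apply, v, w]
    refine Finset.sum_congr rfl fun l _ => ?_
    simp only [Matrix.mul_apply, Matrix.of_apply, Matrix.conjTranspose_apply,
      Matrix.transpose_apply, star_sum, star_mul', Finset.sum_mul, Finset.mul_sum]
    exact Finset.sum_congr rfl fun _ _ => Finset.sum_congr rfl fun _ _ => by ring
  have h2 : ∀ l, star v ⬝ᵥ w l = inner ℂ (vec P) (vec (P * (T l)ᵀ)) := by
    intro l
    rw [EuclideanSpace.inner_eq_star_dotProduct, dotProduct_comm]
    rfl
  have h3 : entanglementFidelity Ψ Φ =
      (star v ⬝ᵥ (ampliate Φ (Matrix.vecMulVec v (star v)) *ᵥ v)).re := rfl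
  rw [h3, h1, Matrix.sum_mulVec, dotProduct_sum, Complex.re_sum]
  refine Finset.sum_congr rfl fun l _ => ?_
  rw [Matrix.vecMulVec_mulVec, dotProduct_smul, ← h2]
  have h4 : star (w l) ⬝ᵥ v = star (star v ⬝ᵥ w l) := by
    rw [Matrix.star_dotProduct]
  rw [h4]
  simp only [MulOpposite.smul_eq_mul_unop, MulOpposite.unop_op, RCLike.star_def,
    Complex.mul_conj']
  exact_mod_cast Complex.ofReal_re _

theorem entanglementFidelity_le_one [∀ i, DecidableEq (a i)] (Ψ : ∀ i, PureState (r i) (a i))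
    {Φ : SuperOp (∀ i, a i) (∀ i, a i)} (hΦ : IsOperation Φ) : entanglementFidelity Ψ Φ ≤ 1 := by
  obtain ⟨m, T, hT⟩ := hΦ.completelyPositive.exists_hasKraus
  have h1 : ‖vec (tens fun i => (Ψ i).mat)‖ = 1 := by
    simp [norm_vec_tens, PureState.norm_vec_mat]
  rw [entanglementFidelity_eq_sum Ψ hT]
  calc _ ≤ ∑ l, ‖vec ((tens fun i => (Ψ i).mat) * (T l)ᵀ)‖ ^ 2 := by
        gcongr with l
        simpa [h1] using norm_inner_le_norm (𝕜 := ℂ) (vec (tens fun i => (Ψ i).mat))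
          (vec ((tens fun i => (Ψ i).mat) * (T l)ᵀ))
    _ ≤ _ := (hΦ.isSubnormalized hT).sum_norm_vec_sq_le _
    _ = 1 := by rw [h1, one_pow]

/-- A product encoding can be replaced by product pure inputs without loss of fidelity. -/
theorem exists_pure_inputs [∀ i, DecidableEq (a i)] [∀ i, DecidableEq (b i)]
    (Ψ : ∀ i, PureState (r i) (a i)) {E : ∀ i, SuperOp (a i) (b i)} (hE : ∀ i, IsOperation (E i))
    {G : SuperOp (∀ i, b i) (∀ i, a i)} {L : Type*} [Fintype L]
    {T : L → Matrix (∀ i, a i) (∀ i, b i) ℂ} (hT : HasKraus G T)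
    (hF : 0 < entanglementFidelity Ψ (G ∘ₗ tensorMap E)) :
    ∃ N : ∀ i, Matrix (r i) (b i) ℂ, (∀ i, ‖vec (N i)‖ = 1) ∧
      entanglementFidelity Ψ (G ∘ₗ tensorMap E) ≤ ∑ l, ‖inner ℂ
        (vec (tens fun i => (Ψ i).mat)) (vec (tens N * (T l)ᵀ))‖ ^ 2 := by
  choose m S hS using fun i => (hE i).completelyPositive.exists_hasKraus
  set F := entanglementFidelity Ψ (G ∘ₗ tensorMap E) with hFdef
  have hsum := entanglementFidelity_eq_sum Ψ (hT.comp (HasKraus.tensorMap hS))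
  rw [← hFdef, Fintype.sum_prod_type, Finset.sum_comm] at hsum
  let M : (∀ i, Fin (m i)) → ∀ i, Matrix (r i) (b i) ℂ := fun j i => (Ψ i).mat * (S i (j i))ᵀ
  let f : (∀ i, Fin (m i)) → ℝ := fun j => ∑ l, ‖inner ℂ
    (vec (tens fun i => (Ψ i).mat)) (vec (tens (M j) * (T l)ᵀ))‖ ^ 2
  have hsum' : F = ∑ j, f j := by
    rw [hsum]
    refine Finset.sum_congr rfl fun j _ => Finset.sum_congr rfl fun l _ => ?_
    rw [Matrix.transpose_mul, ← Matrix.mul_assoc, tens_transpose, ← tens_mul]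
  have hp : ∑ j, ∏ i, ‖vec (M j i)‖ ^ 2 ≤ 1 := by
    rw [← Fintype.prod_sum fun i l => ‖vec ((Ψ i).mat * (S i l)ᵀ)‖ ^ 2]
    refine Finset.prod_le_one (fun i _ => Finset.sum_nonneg fun _ _ => by positivity) fun i _ => ?_
    have := ((hE i).isSubnormalized (hS i)).sum_norm_vec_sq_le (Ψ i).mat
    rwa [(Ψ i).norm_vec_mat, one_pow] at this
  have hf0 : ∀ j, (∏ i, ‖vec (M j i)‖) = 0 → f j = 0 := by
    intro j hj
    rw [← norm_vec_tens, norm_eq_zero] at hj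
    have hz : tens (M j) = 0 := by
      ext x y
      exact congrFun (congrArg WithLp.ofLp hj) (x, y)
    refine Finset.sum_eq_zero fun l _ => ?_
    rw [hz, Matrix.zero_mul]
    have : vec (0 : Matrix (∀ i, r i) (∀ i, a i) ℂ) = 0 := rfl
    rw [this, inner_zero_right]
    simp
  -- Averaging: the weights sum to at most one, and branches of weight zero contribute nothing. If
  -- every other branch fell short of `F` times its weight, the sum would be less than `F`.
  obtain ⟨j, hj0, hj⟩ : ∃ j, (∏ i, ‖vec (M j i)‖) ≠ 0 ∧ F * ∏ i, ‖vec (M j i)‖ ^ 2 ≤ f j := by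
    by_contra! hcon
    have hle : ∀ j, f j ≤ F * ∏ i, ‖vec (M j i)‖ ^ 2 := by
      intro j
      by_cases hj : (∏ i, ‖vec (M j i)‖) = 0
      · rw [hf0 j hj]
        exact mul_nonneg hF.le (Finset.prod_nonneg fun _ _ => by positivity)
      · exact (hcon j hj).le
    obtain ⟨j₀, -, hj₀⟩ : ∃ j ∈ Finset.univ, f j ≠ 0 :=
      Finset.exists_ne_zero_of_sum_ne_zero (hsum' ▸ hF.ne')
    have hlt : ∑ j, f j < ∑ j, F * ∏ i, ‖vec (M j i)‖ ^ 2 :=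
      Finset.sum_lt_sum (fun j _ => hle j) ⟨j₀, Finset.mem_univ _,
        hcon j₀ fun h => hj₀ (hf0 j₀ h)⟩
    rw [← hsum', ← Finset.mul_sum] at hlt
    nlinarith
  have hne : ∀ i, ‖vec (M j i)‖ ≠ 0 := fun i => Finset.prod_ne_zero_iff.1 hj0 i (Finset.mem_univ i)
  refine ⟨fun i => ((‖vec (M j i)‖⁻¹ : ℝ) : ℂ) • M j i, fun i => ?_, ?_⟩
  · rw [vec_smul, norm_smul, Complex.norm_real, norm_inv, norm_norm, inv_mul_cancel₀ (hne i)]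
  have htens : tens (fun i => ((‖vec (M j i)‖⁻¹ : ℝ) : ℂ) • M j i) =
      ((∏ i, ‖vec (M j i)‖⁻¹ : ℝ) : ℂ) • tens (M j) := by
    ext x y
    simp [tens_apply, Finset.prod_mul_distrib]
  have hpos : 0 < ∏ i, ‖vec (M j i)‖ ^ 2 :=
    Finset.prod_pos fun i _ => by have := hne i; positivity
  have heq : ∑ l, ‖inner ℂ (vec (tens fun i => (Ψ i).mat))
      (vec (tens (fun i => ((‖vec (M j i)‖⁻¹ : ℝ) : ℂ) • M j i) * (T l)ᵀ))‖ ^ 2 =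
      (∏ i, ‖vec (M j i)‖ ^ 2)⁻¹ * f j := by
    rw [Finset.mul_sum]
    refine Finset.sum_congr rfl fun l _ => ?_
    rw [htens, Matrix.smul_mul, vec_smul, inner_smul_right, norm_mul, mul_pow, Complex.norm_real,
      Real.norm_eq_abs, sq_abs, ← Finset.prod_pow, ← Finset.prod_inv_distrib]
    simp only [inv_pow]
  rw [heq, le_inv_mul_iff₀ hpos, mul_comm]
  exact hj

end Fidelity

end

end MultiuserQuantum

/-! ### One-shot recovery without encodings -/

namespace MultiuserQuantum

noncomputable section

/-- The completely positive map with given Kraus operators. -/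
def krausMap {a b L : Type*} [Fintype a] [Fintype L] (T : L → Matrix b a ℂ) : SuperOp a b where
  toFun X := ∑ l, T l * X * (T l)ᴴ
  map_add' X Y := by simp [Matrix.mul_add, Matrix.add_mul, Finset.sum_add_distrib]
  map_smul' z X := by simp [Finset.smul_sum]

theorem hasKraus_krausMap {a b L : Type*} [Fintype a] [Fintype L] (T : L → Matrix b a ℂ) :
    HasKraus (krausMap T) T := fun _ => rfl

/-- The adjoint of a contraction is a Kraus operator of a quantum channel. -/
theorem exists_isChannel_hasKraus {a b : Type*} [Fintype a] [Fintype b] [DecidableEq a]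
    [Nonempty b] {K : Matrix a b ℂ} (hK : (1 - K * Kᴴ).PosSemidef) :
    ∃ (D : SuperOp a b) (S : Option a → Matrix b a ℂ),
      IsChannel D ∧ HasKraus D S ∧ S none = Kᴴ := by
  classical
  obtain ⟨B, hB⟩ := exists_eq_conjTranspose_mul_self hK
  let y₀ : b := Classical.arbitrary b
  -- The defect `1 - K * Kᴴ = Bᴴ * B` is filled by Kraus operators that send everything to the basis
  -- vector `y₀`.
  let S : Option a → Matrix b a ℂ := fun o => o.elim Kᴴ fun x =>
    Matrix.of fun y z => if y = y₀ then B x z else 0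
  have hS : HasKraus (krausMap S) S := hasKraus_krausMap S
  refine ⟨krausMap S, S, ⟨hS.isCompletelyPositive, fun X => ?_⟩, hS, rfl⟩
  have h1 : ∑ o, (S o)ᴴ * S o = 1 := by
    have h2 : ∑ x, (S (some x))ᴴ * S (some x) = Bᴴ * B := by
      ext z z'
      simp only [S, Option.elim_some, Matrix.sum_apply, Matrix.mul_apply,
        Matrix.conjTranspose_apply, Matrix.of_apply]
      refine Finset.sum_congr rfl fun x _ => ?_
      rw [Finset.sum_eq_single y₀ (fun y _ hy => by simp [hy]) (by simp)]
      simp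
    rw [Fintype.sum_option, h2, ← hB]
    simp [S]
  rw [hS.trace_apply, h1, Matrix.one_mul]

section Hilbert

variable {E : Type*} [NormedAddCommGroup E] [InnerProductSpace ℂ E]

theorem norm_sub_le_sqrt {x y : E} (hx : ‖x‖ ≤ 1) (hy : ‖y‖ ≤ 1) {t : ℝ}
    (h : t ≤ (inner ℂ x y).re) : ‖x - y‖ ≤ √(2 - 2 * t) := by
  refine Real.le_sqrt_of_sq_le ?_
  have h1 := norm_sub_sq (𝕜 := ℂ) x y
  have h2 : ‖x‖ ^ 2 ≤ 1 := pow_le_one₀ (norm_nonneg _) hx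
  have h3 : ‖y‖ ^ 2 ≤ 1 := pow_le_one₀ (norm_nonneg _) hy
  have h4 : RCLike.re (inner ℂ x y) = (inner ℂ x y).re := rfl
  rw [h4] at h1
  linarith

/-- Two vectors near the same unit vector overlap: `⟨u, w⟩ = 1 - ⟨x - u, w⟩ - ⟨x, x - w⟩`. -/
theorem one_sub_le_norm_inner {x u w : E} (hx : ‖x‖ = 1) (hw : ‖w‖ ≤ 1) :
    1 - ‖x - u‖ - ‖x - w‖ ≤ ‖inner ℂ u w‖ := by
  have h1 : inner ℂ u w = 1 - (inner ℂ (x - u) w + inner ℂ x (x - w)) := by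
    rw [inner_sub_left, inner_sub_right, inner_self_eq_norm_sq_to_K, hx]
    simp
  have h2 := norm_inner_le_norm (𝕜 := ℂ) (x - u) w
  have h3 := norm_inner_le_norm (𝕜 := ℂ) x (x - w)
  have h4 := norm_add_le (inner ℂ (x - u) w) (inner ℂ x (x - w))
  have h5 := norm_sub_norm_le (1 : ℂ) (inner ℂ (x - u) w + inner ℂ x (x - w))
  rw [← h1, norm_one] at h5
  have h6 : ‖x - u‖ * ‖w‖ ≤ ‖x - u‖ := mul_le_of_le_one_right (norm_nonneg _) hw
  rw [hx, one_mul] at h3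
  linarith

end Hilbert

theorem PureState.mat_ofMat {r a : Type*} [Fintype r] [Fintype a] (M : Matrix r a ℂ)
    (h : ‖vec M‖ = 1) : (PureState.ofMat M h).mat = M := rfl

theorem PureState.reduced_eq {r a : Type*} [Fintype r] [Fintype a] (Ψ : PureState r a) :
    Ψ.reduced = Ψ.matᵀ * Ψ.matᵀᴴ := rfl

/-- The pure state proportional to `(1 ⊗ Kᴴ) Ψ` has reduced state proportional to `Kᴴ ρ K`. -/
theorem PureState.smul_reduced_ofMat {r a b : Type*} [Fintype r] [Fintype a] [Fintype b]
    (Ψ : PureState r a) (K : Matrix a b ℂ) {q : ℝ} (hq : q ≠ 0)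
    (h : ‖vec (((q⁻¹ : ℝ) : ℂ) • (Ψ.mat * Kᴴᵀ))‖ = 1) :
    ((q ^ 2 : ℝ) : ℂ) • (PureState.ofMat _ h).reduced = Kᴴ * Ψ.reduced * K := by
  have hq' : (q : ℂ) ≠ 0 := by exact_mod_cast hq
  rw [PureState.reduced_eq, PureState.reduced_eq, PureState.mat_ofMat]
  simp only [Matrix.transpose_smul, Matrix.transpose_mul, Matrix.transpose_transpose,
    Matrix.conjTranspose_smul, Matrix.conjTranspose_mul, Matrix.conjTranspose_conjTranspose,
    Matrix.smul_mul, Matrix.mul_smul, smul_smul, Matrix.mul_assoc]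
  have : ((q ^ 2 : ℝ) : ℂ) * (star ((q⁻¹ : ℝ) : ℂ) * ((q⁻¹ : ℝ) : ℂ)) = 1 := by
    rw [RCLike.star_def, Complex.conj_ofReal]
    push_cast
    field_simp
  rw [this, one_smul]

/-- A lower bound for the amplitude with which the channel inputs of `k` senders can be recovered from
a decoding of fidelity `g ^ 2`. -/
def recoveryAmplitude (k : ℕ) (g : ℝ) : ℝ := 1 - 2 * √(2 - 2 * g ^ k) - √(2 - 2 * g)

section OneShot

variable {k : ℕ} {r a b : Fin k → Type*} [∀ i, Fintype (r i)] [∀ i, Fintype (a i)]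
  [∀ i, Fintype (b i)] [∀ i, DecidableEq (b i)]

/-- From the Kraus operators of an operation that takes the product input `N` to the product state
`Ψ`, a single contraction with the same transition amplitude can be combined. -/
theorem exists_contraction (Ψ : ∀ i, PureState (r i) (a i))
    {L : Type*} [Fintype L] {T : L → Matrix (∀ i, a i) (∀ i, b i) ℂ}
    (hT : IsSubnormalized T)
    (N : ∀ i, Matrix (r i) (b i) ℂ)
    (hF : 0 < ∑ l, ‖inner ℂ (vec (tens fun i => (Ψ i).mat)) (vec (tens N * (T l)ᵀ))‖ ^ 2) :
    ∃ K : Matrix (∀ i, a i) (∀ i, b i) ℂ,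
      (∀ (M : Matrix (∀ i, r i) (∀ i, a i) ℂ) (N : Matrix (∀ i, r i) (∀ i, b i) ℂ),
        ‖inner ℂ (vec M) (vec (N * Kᵀ))‖ ≤ ‖vec M‖ * ‖vec N‖) ∧
      (∀ (M : Matrix (∀ i, r i) (∀ i, a i) ℂ) (N : Matrix (∀ i, r i) (∀ i, b i) ℂ),
        ‖inner ℂ (vec M) (vec (N * Kᵀ))‖ ^ 2 ≤ ∑ l, ‖inner ℂ (vec M) (vec (N * (T l)ᵀ))‖ ^ 2) ∧
      inner ℂ (vec (tens fun i => (Ψ i).mat)) (vec (tens N * Kᵀ)) =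
        ((√(∑ l, ‖inner ℂ (vec (tens fun i => (Ψ i).mat))
          (vec (tens N * (T l)ᵀ))‖ ^ 2) : ℝ) : ℂ) := by
  set z : L → ℂ := fun l => inner ℂ (vec (tens fun i => (Ψ i).mat)) (vec (tens N * (T l)ᵀ)) with hz
  set f := √(∑ l, ‖z l‖ ^ 2) with hf
  have hf0 : 0 < f := Real.sqrt_pos.2 hF
  have hf2 : f ^ 2 = ∑ l, ‖z l‖ ^ 2 := Real.sq_sqrt hF.le
  -- The equality case of Cauchy–Schwarz: coefficients proportional to the conjugate amplitudes make
  -- all terms add in phase.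
  let α : L → ℂ := fun l => ((f⁻¹ : ℝ) : ℂ) * star (z l)
  have hα : ∑ l, ‖α l‖ ^ 2 ≤ 1 := by
    have : ∀ l, ‖α l‖ ^ 2 = (f ^ 2)⁻¹ * ‖z l‖ ^ 2 := fun l => by
      simp only [α, norm_mul, norm_star, mul_pow, Complex.norm_real, Real.norm_eq_abs, sq_abs,
        inv_pow]
    simp only [this, ← Finset.mul_sum, ← hf2]
    rw [inv_mul_cancel₀ (by positivity)]
  refine ⟨∑ l, α l • T l, fun M N => hT.norm_inner_vec_le hα M N, fun M N =>
    sq_norm_inner_vec_sum_le T hα M N, ?_⟩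
  simp only [Matrix.transpose_sum, Matrix.mul_sum, vec_sum, inner_sum, Matrix.transpose_smul,
    Matrix.mul_smul, vec_smul, inner_smul_right]
  have : ∀ l, α l * z l = ((f⁻¹ * ‖z l‖ ^ 2 : ℝ) : ℂ) := fun l => by
    simp only [α, mul_assoc, RCLike.star_def, Complex.conj_mul']
    push_cast
    ring
  change ∑ l, α l * z l = f
  simp only [this]
  rw [← Complex.ofReal_sum, ← Finset.mul_sum, ← hf2]
  congr 1
  field_simp

variable [∀ i, DecidableEq (a i)]

/-- If an operation `G` and product encodings transmit the product state `Ψ` with positive fidelity,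
then `G`, followed by local channels, transmits some product state `Φ` without encoding, and the
entropies of `Φ` are close to those of `Ψ`. -/
theorem exists_recovery (Ψ : ∀ i, PureState (r i) (a i)) {E : ∀ i, SuperOp (a i) (b i)}
    (hE : ∀ i, IsOperation (E i)) {G : SuperOp (∀ i, b i) (∀ i, a i)} (hG : IsOperation G)
    (hF : 0 < entanglementFidelity Ψ (G ∘ₗ tensorMap E)) [∀ i, Nonempty (b i)] :
    ∃ (Φ : ∀ i, PureState (r i) (b i)) (D : ∀ i, SuperOp (a i) (b i)) (c : Fin k → ℝ),
      (∀ i, IsChannel (D i)) ∧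
      (∀ i, entanglementFidelity Ψ (G ∘ₗ tensorMap E) ≤ c i ∧ c i ≤ 1 ∧
        |(Φ i).entropy - (Ψ i).entropy| ≤ (Real.negMulLog (c i) + Real.negMulLog (1 - c i) +
          (1 - c i) * (1 + Real.log (Fintype.card (a i)) + Real.log (Fintype.card (b i)))) /
            Real.log 2) ∧
      recoveryAmplitude k √(entanglementFidelity Ψ (G ∘ₗ tensorMap E)) ≤
        √(entanglementFidelity Φ (tensorMap D ∘ₗ G)) := by
  obtain ⟨m, T, hT⟩ := hG.completelyPositive.exists_hasKraus
  obtain ⟨N, hN, hNF⟩ := exists_pure_inputs Ψ hE hT hF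
  set F := entanglementFidelity Ψ (G ∘ₗ tensorMap E)
  have hTs := hG.isSubnormalized hT
  obtain ⟨K, hK, hKT, hKf⟩ := exists_contraction Ψ hTs N (hF.trans_le hNF)
  set P : ∀ i, Matrix (r i) (a i) ℂ := fun i => (Ψ i).mat with hPdef
  have hP : ∀ i, ‖vec (P i)‖ = 1 := fun i => (Ψ i).norm_vec_mat
  set f := √(∑ l, ‖inner ℂ (vec (tens P)) (vec (tens N * (T l)ᵀ))‖ ^ 2) with hf
  have hf0 : 0 < f := Real.sqrt_pos.2 (hF.trans_le hNF)
  have hFf : √F ≤ f := Real.sqrt_le_sqrt hNF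
  let κ : ∀ i, Matrix (a i) (b i) ℂ := localOp K fun j => (P j)ᴴ * N j
  have hκ : ∀ i (M' : Matrix (r i) (a i) ℂ) (N' : Matrix (r i) (b i) ℂ),
      ‖inner ℂ (vec M') (vec (N' * (κ i)ᵀ))‖ ≤ ‖vec M'‖ * ‖vec N'‖ := fun i M' N' =>
    norm_inner_vec_localOp_le hK hP hN i M' N'
  have hκf : ∀ i, inner ℂ (vec (P i)) (vec (N i * (κ i)ᵀ)) = (f : ℂ) := fun i => by
    rw [inner_vec_localOp, Function.update_eq_self, Function.update_eq_self, hKf]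
  have hκ' : ∀ i (M' : Matrix (r i) (b i) ℂ) (N' : Matrix (r i) (a i) ℂ),
      ‖inner ℂ (vec M') (vec (N' * (κ i)ᴴᵀ))‖ ≤ ‖vec M'‖ * ‖vec N'‖ := fun i =>
    norm_inner_vec_conjTranspose_le (hκ i)
  have hr : ∀ i, Nonempty (r i) := fun i => by
    by_contra hempty
    rw [not_nonempty_iff] at hempty
    have := hP i
    rw [show vec (P i) = 0 from Subsingleton.elim _ _, norm_zero] at this
    exact zero_ne_one this
  have hκ1 : ∀ i, (1 - (κ i)ᴴ * κ i).PosSemidef := fun i =>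
    posSemidef_one_sub_conjTranspose_mul (hκ i)
  have hκ2 : ∀ i, (1 - κ i * (κ i)ᴴ).PosSemidef := fun i => by
    have := posSemidef_one_sub_conjTranspose_mul (hκ' i)
    rwa [Matrix.conjTranspose_conjTranspose] at this
  -- The bounds `f ≤ q i ≤ 1` hold because `⟨κᵢᴴ Ψᵢ, Nᵢ⟩ = f` with `Nᵢ` a unit vector, and `κᵢᴴ` is
  -- a contraction.
  let q : Fin k → ℝ := fun i => ‖vec (P i * (κ i)ᴴᵀ)‖
  have hqf : ∀ i, f ≤ q i := fun i => by
    have h1 := norm_inner_le_norm (𝕜 := ℂ) (vec (P i * (κ i)ᴴᵀ)) (vec (N i))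
    rwa [← inner_vec_mul_transpose_left, hκf, hN, mul_one, Complex.norm_real,
      Real.norm_of_nonneg hf0.le] at h1
  have hq0 : ∀ i, 0 < q i := fun i => hf0.trans_le (hqf i)
  have hq1 : ∀ i, q i ≤ 1 := fun i => by
    have := norm_vec_mul_transpose_le (hκ' i) (P i)
    rwa [hP] at this
  have hnorm : ∀ i, ‖vec ((((q i)⁻¹ : ℝ) : ℂ) • (P i * (κ i)ᴴᵀ))‖ = 1 := fun i => by
    rw [vec_smul, norm_smul, Complex.norm_real, norm_inv, Real.norm_of_nonneg (hq0 i).le]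
    exact inv_mul_cancel₀ (hq0 i).ne'
  choose D S hD hDS hS using fun i => exists_isChannel_hasKraus (hκ2 i)
  refine ⟨fun i => PureState.ofMat _ (hnorm i), D, fun i => q i ^ 2, hD, fun i => ⟨?_, ?_, ?_⟩, ?_⟩
  · exact (Real.sqrt_le_left (hq0 i).le).1 (hFf.trans (hqf i))
  · exact pow_le_one₀ (hq0 i).le (hq1 i)
  · exact (Ψ i).abs_entropy_sub_le _ (hκ1 i) (by have := hq0 i; positivity)
      (pow_le_one₀ (hq0 i).le (hq1 i)) ((Ψ i).smul_reduced_ofMat _ (hq0 i).ne' (hnorm i))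
  let Q : ∀ i, Matrix (r i) (b i) ℂ := fun i => (((q i)⁻¹ : ℝ) : ℂ) • (P i * (κ i)ᴴᵀ)
  have hPQ : ∀ i, inner ℂ (vec (P i)) (vec (Q i * (κ i)ᵀ)) = (q i : ℂ) := fun i => by
    have hqi : (q i : ℂ) ≠ 0 := by exact_mod_cast (hq0 i).ne'
    rw [inner_vec_mul_transpose_left, vec_smul, inner_smul_right, inner_self_eq_norm_sq_to_K]
    change (((q i)⁻¹ : ℝ) : ℂ) * (q i : ℂ) ^ 2 = q i
    push_cast
    field_simp
  have hNQ : ∀ i, inner ℂ (vec (N i)) (vec (Q i)) = ((f / q i : ℝ) : ℂ) := fun i => by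
    rw [vec_smul, inner_smul_right, ← inner_conj_symm, ← inner_vec_mul_transpose_left, hκf,
      Complex.conj_ofReal]
    push_cast
    ring
  have hg0 : 0 ≤ √F := Real.sqrt_nonneg _
  have hprod : ∀ t : Fin k → ℝ, (∀ i, √F ≤ t i) → √F ^ k ≤ ∏ i, t i := fun t ht => by
    have := Finset.prod_le_prod (s := Finset.univ) (fun i _ => hg0) fun i _ => ht i
    simpa using this
  have hψ : ‖vec (tens P)‖ = 1 := by simp [norm_vec_tens, hP]
  have hφ : ‖vec (tens N)‖ = 1 := by simp [norm_vec_tens, hN]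
  have hQ : ‖vec (tens Q)‖ = 1 := by rw [norm_vec_tens, Finset.prod_eq_one fun i _ => hnorm i]
  have hu1 : ‖vec (tens fun i => Q i * (κ i)ᵀ)‖ ≤ 1 := by
    rw [norm_vec_tens]
    refine Finset.prod_le_one (fun _ _ => norm_nonneg _) fun i _ => ?_
    exact (norm_vec_mul_transpose_le (hκ i) _).trans_eq (hnorm i)
  -- The overlaps of the tensor products are products of `k` local overlaps, each at least `√F`;
  -- hence the power `k`.
  have hd1 : ‖vec (tens P) - vec (tens fun i => Q i * (κ i)ᵀ)‖ ≤ √(2 - 2 * √F ^ k) := by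
    refine norm_sub_le_sqrt hψ.le hu1 ?_
    rw [inner_vec_tens]
    simp only [hPQ]
    rw [← Complex.ofReal_prod, Complex.ofReal_re]
    exact hprod _ fun i => hFf.trans (hqf i)
  have hd2 : ‖vec (tens N) - vec (tens Q)‖ ≤ √(2 - 2 * √F ^ k) := by
    refine norm_sub_le_sqrt hφ.le hQ.le ?_
    rw [inner_vec_tens]
    simp only [hNQ]
    rw [← Complex.ofReal_prod, Complex.ofReal_re]
    exact hprod _ fun i => hFf.trans (le_div_self hf0.le (hq0 i) (hq1 i))
  have hd3 : ‖vec (tens P) - vec (tens N * Kᵀ)‖ ≤ √(2 - 2 * √F) := by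
    refine norm_sub_le_sqrt hψ.le ((norm_vec_mul_transpose_le hK _).trans_eq hφ) ?_
    rw [hKf, Complex.ofReal_re]
    exact hFf
  have hd4 : ‖vec (tens N * Kᵀ) - vec (tens Q * Kᵀ)‖ ≤ √(2 - 2 * √F ^ k) := by
    rw [← vec_sub, ← Matrix.sub_mul]
    refine (norm_vec_mul_transpose_le hK _).trans ?_
    rwa [vec_sub]
  have hmain : recoveryAmplitude k √F ≤
      ‖inner ℂ (vec (tens fun i => Q i * (κ i)ᵀ)) (vec (tens Q * Kᵀ))‖ := by
    have h1 := one_sub_le_norm_inner (u := vec (tens fun i => Q i * (κ i)ᵀ))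
      (w := vec (tens Q * Kᵀ)) hψ ((norm_vec_mul_transpose_le hK _).trans_eq hQ)
    have h2 := norm_sub_le_norm_sub_add_norm_sub (vec (tens P)) (vec (tens N * Kᵀ))
      (vec (tens Q * Kᵀ))
    rw [recoveryAmplitude]
    linarith
  -- Among the nonnegative terms of the new fidelity, only those with Kraus operator `κᵢᴴ` (index
  -- `none`) for every `D i` are kept. By `hKT` their sum dominates the squared amplitude of `K`.
  refine hmain.trans (Real.le_sqrt_of_sq_le ((hKT _ _).trans ?_))
  rw [entanglementFidelity_eq_sum _ ((HasKraus.tensorMap hDS).comp hT), Fintype.sum_prod_type]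
  refine le_trans (le_of_eq ?_) (Finset.single_le_sum
    (fun _ _ => Finset.sum_nonneg fun _ _ => by positivity)
    (Finset.mem_univ fun _ : Fin k => none))
  refine Finset.sum_congr rfl fun l _ => ?_
  change _ = ‖inner ℂ (vec (tens Q))
    (vec (tens Q * (tens (fun i => S i none) * T l)ᵀ))‖ ^ 2
  rw [Matrix.transpose_mul, ← Matrix.mul_assoc, inner_vec_mul_transpose_left (tens Q)]
  simp only [hS, tens_conjTranspose, Matrix.conjTranspose_conjTranspose, tens_transpose,
    ← tens_mul]

end OneShot

end

end MultiuserQuantum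

/-! ### Asymptotics and preservation of rates -/

namespace MultiuserQuantum

noncomputable section

theorem tendsto_recoveryAmplitude (k : ℕ) : Tendsto (recoveryAmplitude k) (𝓝 1) (𝓝 1) := by
  have h : Continuous (recoveryAmplitude k) := by
    unfold recoveryAmplitude
    fun_prop
  simpa [recoveryAmplitude] using h.tendsto 1

theorem PureState.nonempty_left {r a : Type*} [Fintype r] [Fintype a] (Ψ : PureState r a) :
    Nonempty r := by
  by_contra h
  rw [not_nonempty_iff] at h
  simpa using Ψ.norm_one

theorem exists_pureState (r a : Type*) [Fintype r] [Fintype a] [Nonempty r] [Nonempty a] :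
    Nonempty (PureState r a) := by
  classical
  exact ⟨⟨Pi.single (Classical.arbitrary _) 1, by simp [Pi.single_apply, apply_ite]⟩⟩

theorem exists_isChannel (a b : Type*) [Fintype a] [Fintype b] [Nonempty b] :
    ∃ D : SuperOp a b, IsChannel D := by
  classical
  obtain ⟨D, -, hD, -⟩ := exists_isChannel_hasKraus (K := (0 : Matrix a b ℂ))
    (by simpa using Matrix.PosSemidef.one)
  exact ⟨D, hD⟩

theorem entanglementFidelity_zero {k : ℕ} {r a : Fin k → Type*} [∀ i, Fintype (r i)]
    [∀ i, Fintype (a i)] (Ψ : ∀ i, PureState (r i) (a i)) : entanglementFidelity Ψ 0 = 0 := by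
  rw [entanglementFidelity_eq_sum Ψ (L := Empty) (T := Empty.elim) fun X => by simp]
  simp

/-- Asymptotic form of `exists_recovery`: a family of operations that, together with product
encodings, transmits sources reliably can be completed by local channels so that it transmits
sources with the same rates reliably without encodings. -/
theorem exists_reliable_recovery {k : ℕ} {s a : Fin k → Type*}
    [∀ i, Fintype (s i)] [∀ i, DecidableEq (s i)] [∀ i, Fintype (a i)] [∀ i, DecidableEq (a i)]
    {G : ∀ n : ℕ, SuperOp (∀ i, Fin n → a i) (∀ i, Fin n → s i)} (hG : ∀ n, IsOperation (G n))
    {E : ∀ (n : ℕ) (i : Fin k), SuperOp (Fin n → s i) (Fin n → a i)}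
    (hE : ∀ n i, IsOperation (E n i)) {S : ∀ i, Source (s i)} {R : Fin k → ℝ}
    (hF : Tendsto (fun n => entanglementFidelity (fun i => (S i).state n)
      (G n ∘ₗ tensorMap (E n))) atTop (𝓝 1))
    (hR : ∀ i, (S i).HasRate (R i)) :
    ∃ (D : ∀ (n : ℕ) (i : Fin k), SuperOp (Fin n → s i) (Fin n → a i))
      (S' : ∀ i, Source (a i)), (∀ n i, IsChannel (D n i)) ∧
      Tendsto (fun n => entanglementFidelity (fun i => (S' i).state n)
        (tensorMap (D n) ∘ₗ G n)) atTop (𝓝 1) ∧ ∀ i, (S' i).HasRate (R i) := by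
  set F : ℕ → ℝ := fun n => entanglementFidelity (fun i => (S i).state n)
      (G n ∘ₗ tensorMap (E n)) with hFdef
  have hpos : ∀ᶠ n in atTop, 0 < F n := hF.eventually (lt_mem_nhds one_pos)
  -- Channels into a zero-dimensional space need not exist. An empty `a i` would make the encoding
  -- zero for `n ≥ 1`, contradicting positive fidelity.
  have hne : ∀ i, Nonempty (a i) := by
    intro i
    by_contra hempty
    rw [not_nonempty_iff] at hempty
    obtain ⟨n, hn, hn1⟩ := (hpos.and (eventually_ge_atTop 1)).exists
    have : Nonempty (Fin n) := ⟨⟨0, hn1⟩⟩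
    have : IsEmpty (∀ i, Fin n → a i) := ⟨fun x => hempty.elim (x i ⟨0, hn1⟩)⟩
    have h0 : tensorMap (E n) = 0 := by
      ext X x
      exact isEmptyElim x
    simp only [hFdef, h0, LinearMap.comp_zero, entanglementFidelity_zero, lt_irrefl] at hn
  have hstep : ∀ n, ∃ (Φ : ∀ i, PureState (Fin ((S i).refDim n)) (Fin n → a i))
      (D : ∀ i, SuperOp (Fin n → s i) (Fin n → a i)) (c : Fin k → ℝ), (∀ i, IsChannel (D i)) ∧
      (0 < F n → (∀ i, F n ≤ c i ∧ c i ≤ 1 ∧ |(Φ i).entropy - ((S i).state n).entropy| ≤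
        (Real.negMulLog (c i) + Real.negMulLog (1 - c i) + (1 - c i) *
          (1 + Real.log (Fintype.card (Fin n → s i)) + Real.log (Fintype.card (Fin n → a i)))) /
            Real.log 2) ∧
        recoveryAmplitude k √(F n) ≤ √(entanglementFidelity Φ (tensorMap D ∘ₗ G n))) := by
    intro n
    by_cases hn : 0 < F n
    · obtain ⟨Φ, D, c, h1, h2⟩ := exists_recovery (fun i => (S i).state n) (hE n) (hG n) hn
      exact ⟨Φ, D, c, h1, fun _ => h2⟩
    -- Block lengths without positive fidelity are filled with arbitrary states and channels;
    -- eventually none occur.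
    · have := fun i => ((S i).state n).nonempty_left
      choose D hD using fun i => exists_isChannel (Fin n → s i) (Fin n → a i)
      exact ⟨fun i => (exists_pureState _ _).some, D, 0, hD, fun h => absurd h hn⟩
  choose Φ D c hD hΦ using hstep
  refine ⟨D, fun i => ⟨(S i).refDim, fun n => Φ n i⟩, hD, ?_, fun i => ?_⟩
  · have ht : Tendsto (fun n => recoveryAmplitude k √(F n)) atTop (𝓝 1) :=
      (tendsto_recoveryAmplitude k).comp (by simpa using hF.sqrt)
    refine tendsto_of_tendsto_of_tendsto_of_le_of_le' (by simpa using ht.pow 2)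
      tendsto_const_nhds ?_ (Eventually.of_forall fun n => ?_)
    · filter_upwards [hpos, ht.eventually (lt_mem_nhds one_pos)] with n hn htn
      exact (Real.le_sqrt' htn).1 (hΦ n hn).2
    · exact entanglementFidelity_le_one _
        ((IsOperation.tensorMap fun i => (hD n i).isOperation).comp (hG n))
  · have hc : Tendsto (fun n => c n i) atTop (𝓝 1) :=
      tendsto_of_tendsto_of_tendsto_of_le_of_le' hF tendsto_const_nhds
        (hpos.mono fun n hn => ((hΦ n hn).1 i).1) (hpos.mono fun n hn => ((hΦ n hn).1 i).2.1)
    let e : ℝ → ℝ := fun x => (Real.negMulLog x + Real.negMulLog (1 - x) +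
      (1 - x) * (1 + Real.log (Fintype.card (s i)) + Real.log (Fintype.card (a i)))) / Real.log 2
    have he : Tendsto (fun n => e (c n i)) atTop (𝓝 0) := by
      have hcont : Continuous e := by
        have := Real.continuous_negMulLog
        fun_prop
      have h1 : e 1 = 0 := by simp [e]
      rw [← h1]
      exact (hcont.tendsto 1).comp hc
    have hdiff : Tendsto (fun n => (Φ n i).entropy / n - ((S i).state n).entropy / n)
        atTop (𝓝 0) := by
      refine squeeze_zero_norm' ?_ he
      filter_upwards [hpos, eventually_ge_atTop 1] with n hn hn1
      obtain ⟨h1, h2, h3⟩ := (hΦ n hn).1 i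
      have hn1' : (1 : ℝ) ≤ n := by exact_mod_cast hn1
      have hlog2 : 0 < Real.log 2 := Real.log_pos one_lt_two
      have hη1 := Real.negMulLog_nonneg (hn.le.trans h1) h2
      have hη2 := Real.negMulLog_nonneg (sub_nonneg.2 h2) (by linarith)
      rw [← sub_div, norm_div, Real.norm_eq_abs, Real.norm_natCast, div_le_iff₀ (by linarith)]
      refine h3.trans ?_
      simp only [e]
      rw [div_mul_eq_mul_div]
      gcongr
      -- The block dimensions have logarithms `n` times the one-letter ones, and `n ≥ 1` absorbs the
      -- other terms: after division by `n` the error is at most `e (c n i)`.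
      simp only [Fintype.card_fun, Fintype.card_fin, Nat.cast_pow, Real.log_pow]
      nlinarith [mul_nonneg (sub_nonneg.2 hn1') hη1, mul_nonneg (sub_nonneg.2 hn1') hη2,
        mul_nonneg (sub_nonneg.2 hn1') (sub_nonneg.2 h2)]
    have := hdiff.add (hR i)
    rw [zero_add] at this
    exact this.congr fun n => sub_add_cancel _ _

theorem isOperation_macUses {k : ℕ} {a : Fin k → Type*} {o : Type*}
    [∀ i, Fintype (a i)] [∀ i, DecidableEq (a i)] [Fintype o]
    {Λ : SuperOp (∀ i, a i) o} (hΛ : IsOperation Λ) (n : ℕ) : IsOperation (macUses Λ n) :=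
  (IsOperation.tensorMap fun _ => hΛ).comp (isOperation_relabel _)

theorem isOperation_kucUses {k : ℕ} {a o : Fin k → Type*}
    [∀ i, Fintype (a i)] [∀ i, DecidableEq (a i)] [∀ i, Fintype (o i)]
    {Λ : SuperOp (∀ i, a i) (∀ i, o i)} (hΛ : IsOperation Λ) (n : ℕ) :
    IsOperation (kucUses Λ n) :=
  (isOperation_relabel _).comp
    ((IsOperation.tensorMap fun _ => hΛ).comp (isOperation_relabel _))

end

end MultiuserQuantum

/-! ### Assembly for the two kinds of channel -/

theorem theorem3 {k : ℕ} (s : Fin k → Type*) (a : Fin k → Type*)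
    [∀ i, Fintype (s i)] [∀ i, DecidableEq (s i)]
    [∀ i, Fintype (a i)] [∀ i, DecidableEq (a i)] :
    -- multiple access channel
    (∀ (o : Type*) [Fintype o] [DecidableEq o]
      (Λ : MultiuserQuantum.SuperOp (∀ i, a i) o), MultiuserQuantum.IsChannel Λ →
      ∀ (P : MultiuserQuantum.MACProtocol s a o) (S : ∀ i, MultiuserQuantum.Source (s i))
        (R : Fin k → ℝ),
        P.IsReliable Λ S → (∀ i, (S i).HasRate (R i)) →
        ∃ (D' : ∀ (n : ℕ) (i : Fin k), MultiuserQuantum.SuperOp (Fin n → s i) (Fin n → a i))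
          (P' : MultiuserQuantum.MACProtocol a a o) (S' : ∀ i, MultiuserQuantum.Source (a i)),
          (∀ n i, MultiuserQuantum.IsChannel (D' n i)) ∧
          (∀ n i, P'.enc n i = LinearMap.id) ∧
          (∀ n, P'.dec n = MultiuserQuantum.tensorMap (D' n) ∘ₗ P.dec n) ∧
          P'.IsReliable Λ S' ∧ ∀ i, (S' i).HasRate (R i)) ∧
    -- k-user channel
    (∀ (o : Fin k → Type*) [∀ i, Fintype (o i)] [∀ i, DecidableEq (o i)]
      (Λ : MultiuserQuantum.SuperOp (∀ i, a i) (∀ i, o i)), MultiuserQuantum.IsChannel Λ →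
      ∀ (P : MultiuserQuantum.KUCProtocol s a o) (S : ∀ i, MultiuserQuantum.Source (s i))
        (R : Fin k → ℝ),
        P.IsReliable Λ S → (∀ i, (S i).HasRate (R i)) →
        ∃ (D' : ∀ (n : ℕ) (i : Fin k), MultiuserQuantum.SuperOp (Fin n → s i) (Fin n → a i))
          (P' : MultiuserQuantum.KUCProtocol a a o) (S' : ∀ i, MultiuserQuantum.Source (a i)),
          (∀ n i, MultiuserQuantum.IsChannel (D' n i)) ∧
          (∀ n i, P'.enc n i = LinearMap.id) ∧
          (∀ n i, P'.dec n i = D' n i ∘ₗ P.dec n i) ∧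
          P'.IsReliable Λ S' ∧ ∀ i, (S' i).HasRate (R i)) := by
  constructor
  · intro o _ _ Λ hΛ P S R hP hS
    have hG : ∀ n, MultiuserQuantum.IsOperation
        (P.dec n ∘ₗ MultiuserQuantum.macUses Λ n) := fun n =>
      (P.dec_isOperation n).comp (MultiuserQuantum.isOperation_macUses hΛ.isOperation n)
    obtain ⟨D, S', hD, hrel, hrate⟩ :=
      MultiuserQuantum.exists_reliable_recovery hG P.enc_isOperation hP hS
    refine ⟨D, ⟨fun _ _ => LinearMap.id, fun n => MultiuserQuantum.tensorMap (D n) ∘ₗ P.dec n,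
      fun _ _ => MultiuserQuantum.isOperation_id, fun n =>
        (MultiuserQuantum.IsOperation.tensorMap fun i => (hD n i).isOperation).comp
          (P.dec_isOperation n)⟩, S', hD, fun _ _ => rfl, fun _ => rfl, ?_, hrate⟩
    refine hrel.congr fun n => ?_
    simp only [MultiuserQuantum.MACProtocol.effective, MultiuserQuantum.tensorMap_id,
      LinearMap.comp_id, LinearMap.comp_assoc]
  · intro o _ _ Λ hΛ P S R hP hS
    have hG : ∀ n, MultiuserQuantum.IsOperation
        (MultiuserQuantum.tensorMap (P.dec n) ∘ₗ MultiuserQuantum.kucUses Λ n) := fun n =>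
      (MultiuserQuantum.IsOperation.tensorMap (P.dec_isOperation n)).comp
        (MultiuserQuantum.isOperation_kucUses hΛ.isOperation n)
    obtain ⟨D, S', hD, hrel, hrate⟩ :=
      MultiuserQuantum.exists_reliable_recovery hG P.enc_isOperation hP hS
    refine ⟨D, ⟨fun _ _ => LinearMap.id, fun n i => D n i ∘ₗ P.dec n i,
      fun _ _ => MultiuserQuantum.isOperation_id, fun n i =>
        (hD n i).isOperation.comp (P.dec_isOperation n i)⟩, S', hD, fun _ _ => rfl,
      fun _ _ => rfl, ?_, hrate⟩
    -- Both the recovery and the decoding are tensor products, so they merge factor by factor and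
    -- the new decoding stays local.
    refine hrel.congr fun n => ?_
    simp only [MultiuserQuantum.KUCProtocol.effective, MultiuserQuantum.tensorMap_id,
      MultiuserQuantum.tensorMap_comp, LinearMap.comp_id, LinearMap.comp_assoc]
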